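/- Let $\mathscr{C}_{\mathbb Z}$ be the extended bicyclic semigroup, i.e. the set $\mathbb Z\times\mathbb Z$ with the operation $$(a,b)\cdot(c,d)=\begin{cases}(a-b+c,d),& b<c,\\ (a,d),& b=c,\\ (a,d+b-c),& b>c.\end{cases}$$ For a positive integer $k$ let $G_1(k)=k\mathbb Z$, and let $G_0=\mathbb Z$ (both additive groups; the sets below are disjoint unions). * $S_2=G_1(k)\sqcup\mathscr{C}_{\mathbb Z}$ carries the operation extending those of $G_1(k)$ and $\mathscr{C}_{\mathbb Z}$ with $g\cdot(a,b)=(-g+a,b)$ and $(a,b)\cdot g=(a,b+g)$ for $g\in G_1(k)$. For a positive divisor $n$ of $k$, the topology $\tau_2$ on $S_2$ is the one in which the points of $\mathscr{C}_{\mathbb Z}$ are isolated and the sets $\{g\}\cup\{(-nq,-nq+g)\mid q\ge j\}$, $j=1,2,\dots$, form a base at $g\in G_1(k)$. * $S_3=\mathscr{C}_{\mathbb Z}\sqcup G_0$ carries the operation extending those of $\mathscr{C}_{\mathbb Z}$ and $G_0$ with $(a,b)\cdot m=m\cdot(a,b)=m+b-a\in G_0$ for $m\in G_0$. In the topology $\tau_3$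 on $S_3$ the points of $\mathscr{C}_{\mathbb Z}$ are isolated and a base at $m\in G_0$ is formed by the sets $\{m\}\cup\{(a,a+m)\mid a\ge j\}$ if $m\ge 0$, and $\{m\}\cup\{(a-m,a)\mid a\ge j\}$ if $m\le 0$, $j=1,2,\dots$. * $S_5=G_1(k)\sqcup\mathscr{C}_{\mathbb Z}\sqcup G_0$ carries the operation extending those of $S_2$ and $S_3$ with $g\cdot m=m\cdot g=g+m\in G_0$ for $g\in G_1(k)$, $m\in G_0$, and the topology $\tau_5$ generated by $\tau_2\cup\tau_3$. **Statement.** Let $T$ be a Hausdorff locally compact topological inverse monoid with unit $1_T$ (an inverse semigroup with identity whose multiplication is jointly continuous and whose inversion is continuous) that contains $\mathscr{C}_{\mathbb Z}$ as a dense subsemigroup. Suppose that 1. the group of units of $T$ is non-singleton; and 2. there is an integer $j$ such that $K=\{1_T\}\cup\{(i,i)\in\mathscr{C}_{\mathbb Z}\mid i\le j\}$ is a compact subset of $T$. Then there is a decreasing sequence $(m_i)$ of negative integers with $m_{i+1}=m_i-1$ for every $i$ such that the sets $\{1_T\}\cup\{(m_i,m_i)\mid i\ge p\}$, $p=0,1,2,\dots$,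 form a base of neighbourhoods of $1_T$ in $T$; and there is a positive integer $k$ such that $T$ is topologically isomorphic either to $(S_2,\tau_2)$ or to $(S_5,\tau_5)$ taken with this $k$ and with $n=1$. -/

import Mathlib

open Topology

/-- The semigroup `S` is inverse: every `x` has a unique `y` with `x y x = x` and `y x y = y`. -/
class IsInverseSemigroup (S : Type*) [Semigroup S] : Prop where
  existsUnique_inverse : ∀ x : S, ∃! y : S, x * y * x = x ∧ y * x * y = y

/-- The inversion `x ↦ x⁻¹` of an inverse semigroup. -/
noncomputable def inversion (S : Type*) [Semigroup S] [IsInverseSemigroup S] (x : S) : S :=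
  (IsInverseSemigroup.existsUnique_inverse x).choose

/-- An inverse semigroup with a topology making multiplication (jointly) and inversion continuous.
The Hausdorff property is stated separately. -/
class IsTopologicalInverseSemigroup (S : Type*) [Semigroup S] [TopologicalSpace S] : Prop
    extends IsInverseSemigroup S, ContinuousMul S where
  continuous_inversion : Continuous (inversion S)

/-- The underlying set `ℤ × ℤ` of the extended bicyclic semigroup. -/
@[ext]
structure ExtBicyclic where
  fst : ℤ
  snd : ℤ

namespace ExtBicyclic

instance : Mul ExtBicyclic where
  mul x y :=
    if x.snd < y.fst then ⟨x.fst - x.snd + y.fst, y.snd⟩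
    else if x.snd = y.fst then ⟨x.fst, y.snd⟩
    else ⟨x.fst, y.snd + x.snd - y.fst⟩

theorem mul_def (x y : ExtBicyclic) : x * y =
    if x.snd < y.fst then ⟨x.fst - x.snd + y.fst, y.snd⟩
    else if x.snd = y.fst then ⟨x.fst, y.snd⟩
    else ⟨x.fst, y.snd + x.snd - y.fst⟩ := rfl

instance : Semigroup ExtBicyclic where
  mul_assoc x y z := by
    simp only [mul_def]
    grind

end ExtBicyclic

/-- The group `G₁(k) = kℤ`, a subgroup of the additive group of integers. -/
abbrev G₁ (k : ℕ) : Type := AddSubgroup.zmultiples (k : ℤ)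

/-- The set `S₂ = G₁(k) ⊔ C_ℤ`. The parameter `n` enters only in its topology. -/
inductive S₂ (k n : ℕ) : Type
  | unit (g : G₁ k)
  | bic (x : ExtBicyclic)

namespace S₂

variable {k n : ℕ}

instance : Mul (S₂ k n) where
  mul
    | unit g, unit h => unit (g + h)
    | unit g, bic x => bic ⟨-(g : ℤ) + x.fst, x.snd⟩
    | bic x, unit g => bic ⟨x.fst, x.snd + (g : ℤ)⟩
    | bic x, bic y => bic (x * y)

theorem unit_mul_unit (g h : G₁ k) : (unit g * unit h : S₂ k n) = unit (g + h) := rfl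

theorem unit_mul_bic (g : G₁ k) (x : ExtBicyclic) :
    (unit g * bic x : S₂ k n) = bic ⟨-(g : ℤ) + x.fst, x.snd⟩ := rfl

theorem bic_mul_unit (x : ExtBicyclic) (g : G₁ k) :
    (bic x * unit g : S₂ k n) = bic ⟨x.fst, x.snd + (g : ℤ)⟩ := rfl

theorem bic_mul_bic (x y : ExtBicyclic) : (bic x * bic y : S₂ k n) = bic (x * y) := rfl

instance : Monoid (S₂ k n) where
  mul_assoc := by
    rintro (g | x) (h | y) (l | z) <;>
      simp only [unit_mul_unit, unit_mul_bic, bic_mul_unit, bic_mul_bic, ExtBicyclic.mul_def,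
        bic.injEq, AddSubgroup.coe_add, add_assoc] <;> grind
  one := unit 0
  one_mul := by
    rintro (g | x)
    · exact congrArg unit (zero_add g)
    · exact congrArg bic (by ext <;> simp)
  mul_one := by
    rintro (g | x)
    · exact congrArg unit (add_zero g)
    · exact congrArg bic (by ext <;> simp)

/-- The basic neighbourhood `U_jⁿ(g) = {g} ∪ {(-nq, -nq + g) ∣ q ≥ j}` of `g ∈ G₁(k)`. -/
def basicNhd (g : G₁ k) (j : ℕ) : Set (S₂ k n) :=
  {unit g} ∪ {s | ∃ q : ℕ, j ≤ q ∧ s = bic ⟨-(n * q : ℤ), -(n * q : ℤ) + (g : ℤ)⟩}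

theorem basicNhd_anti (g : G₁ k) {i j : ℕ} (h : i ≤ j) :
    (basicNhd g j : Set (S₂ k n)) ⊆ basicNhd g i := by
  rintro s (hs | ⟨q, hq, hs⟩)
  · exact Or.inl hs
  · exact Or.inr ⟨q, h.trans hq, hs⟩

/-- The topology `τ₂`: points of `C_ℤ` are isolated, and the sets `U_jⁿ(g)`, `j ≥ 1`, form a base
at `g ∈ G₁(k)`. -/
instance : TopologicalSpace (S₂ k n) where
  IsOpen U := ∀ g : G₁ k, unit g ∈ U → ∃ j : ℕ, 1 ≤ j ∧ basicNhd g j ⊆ U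
  isOpen_univ _ _ := ⟨1, le_rfl, Set.subset_univ _⟩
  isOpen_inter U V hU hV g hg := by
    obtain ⟨i, hi, hiU⟩ := hU g hg.1
    obtain ⟨j, hj, hjV⟩ := hV g hg.2
    exact ⟨max i j, hi.trans (le_max_left _ _),
      Set.subset_inter ((basicNhd_anti g (le_max_left _ _)).trans hiU)
        ((basicNhd_anti g (le_max_right _ _)).trans hjV)⟩
  isOpen_sUnion 𝒰 h g := by
    rintro ⟨U, hU, hg⟩
    obtain ⟨j, hj, hjU⟩ := h U hU g hg
    exact ⟨j, hj, hjU.trans (Set.subset_sUnion_of_mem hU)⟩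

theorem isOpen_iff {U : Set (S₂ k n)} :
    IsOpen U ↔ ∀ g : G₁ k, unit g ∈ U → ∃ j : ℕ, 1 ≤ j ∧ basicNhd g j ⊆ U := Iff.rfl

theorem isOpen_singleton_bic (x : ExtBicyclic) : IsOpen ({bic x} : Set (S₂ k n)) := by
  rw [isOpen_iff]
  intro g hg
  simp at hg

theorem nhds_unit_hasBasis (g : G₁ k) :
    (𝓝 (unit g : S₂ k n)).HasBasis (fun j : ℕ => 1 ≤ j) (basicNhd g) := by
  refine ⟨fun U => ?_⟩
  rw [mem_nhds_iff]
  constructor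
  · rintro ⟨V, hVU, hV, hg⟩
    obtain ⟨j, hj, hjV⟩ := hV g hg
    exact ⟨j, hj, hjV.trans hVU⟩
  · rintro ⟨j, hj, hjU⟩
    refine ⟨basicNhd g j, hjU, ?_, Or.inl rfl⟩
    rw [isOpen_iff]
    rintro h (hh | ⟨q, -, hh⟩)
    · obtain rfl : h = g := by simpa using hh
      exact ⟨j, hj, le_rfl⟩
    · simp at hh

end S₂

/-- The set `S₃ = C_ℤ ⊔ G₀`, where `G₀` is the additive group of integers. -/
inductive S₃ : Type
  | bic (x : ExtBicyclic)
  | zer (m : ℤ)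

namespace S₃

instance : Mul S₃ where
  mul
    | bic x, bic y => bic (x * y)
    | bic x, zer m => zer (m + x.snd - x.fst)
    | zer m, bic x => zer (m + x.snd - x.fst)
    | zer m, zer l => zer (m + l)

theorem bic_mul_bic (x y : ExtBicyclic) : bic x * bic y = bic (x * y) := rfl

theorem bic_mul_zer (x : ExtBicyclic) (m : ℤ) : bic x * zer m = zer (m + x.snd - x.fst) := rfl

theorem zer_mul_bic (m : ℤ) (x : ExtBicyclic) : zer m * bic x = zer (m + x.snd - x.fst) := rfl

theorem zer_mul_zer (m l : ℤ) : zer m * zer l = zer (m + l) := rfl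

instance : Semigroup S₃ where
  mul_assoc := by
    rintro (x | m) (y | l) (z | p) <;>
      simp only [bic_mul_bic, bic_mul_zer, zer_mul_bic, zer_mul_zer, ExtBicyclic.mul_def,
        bic.injEq, zer.injEq] <;> grind

/-- The basic neighbourhood `U_j(m)` of `m ∈ G₀`: it is `{m} ∪ {(a, a + m) ∣ a ≥ j}` if `m ≥ 0`
and `{m} ∪ {(a - m, a) ∣ a ≥ j}` if `m ≤ 0`. -/
def basicNhd (m : ℤ) (j : ℕ) : Set S₃ :=
  if 0 ≤ m then {zer m} ∪ {s | ∃ a : ℤ, (j : ℤ) ≤ a ∧ s = bic ⟨a, a + m⟩}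
  else {zer m} ∪ {s | ∃ a : ℤ, (j : ℤ) ≤ a ∧ s = bic ⟨a - m, a⟩}

theorem basicNhd_anti (m : ℤ) {i j : ℕ} (h : i ≤ j) : basicNhd m j ⊆ basicNhd m i := by
  have h' : (i : ℤ) ≤ j := by exact_mod_cast h
  unfold basicNhd
  split_ifs
  all_goals
    rintro s (hs | ⟨a, ha, hs⟩)
    · exact Or.inl hs
    · exact Or.inr ⟨a, h'.trans ha, hs⟩

/-- The topology `τ₃`: points of `C_ℤ` are isolated, and the sets `U_j(m)`, `j ≥ 1`, form a base
at `m ∈ G₀`. -/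
instance : TopologicalSpace S₃ where
  IsOpen U := ∀ m : ℤ, zer m ∈ U → ∃ j : ℕ, 1 ≤ j ∧ basicNhd m j ⊆ U
  isOpen_univ _ _ := ⟨1, le_rfl, Set.subset_univ _⟩
  isOpen_inter U V hU hV m hm := by
    obtain ⟨i, hi, hiU⟩ := hU m hm.1
    obtain ⟨j, hj, hjV⟩ := hV m hm.2
    exact ⟨max i j, hi.trans (le_max_left _ _),
      Set.subset_inter ((basicNhd_anti m (le_max_left _ _)).trans hiU)
        ((basicNhd_anti m (le_max_right _ _)).trans hjV)⟩
  isOpen_sUnion 𝒰 h m := by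
    rintro ⟨U, hU, hm⟩
    obtain ⟨j, hj, hjU⟩ := h U hU m hm
    exact ⟨j, hj, hjU.trans (Set.subset_sUnion_of_mem hU)⟩

theorem isOpen_iff {U : Set S₃} :
    IsOpen U ↔ ∀ m : ℤ, zer m ∈ U → ∃ j : ℕ, 1 ≤ j ∧ basicNhd m j ⊆ U := Iff.rfl

end S₃

/-- The set `S₅ = G₁(k) ⊔ C_ℤ ⊔ G₀`. The parameter `n` enters only in its topology. -/
inductive S₅ (k n : ℕ) : Type
  | unit (g : G₁ k)
  | bic (x : ExtBicyclic)
  | zer (m : ℤ)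

namespace S₅

variable {k n : ℕ}

instance : Mul (S₅ k n) where
  mul
    | unit g, unit h => unit (g + h)
    | unit g, bic x => bic ⟨-(g : ℤ) + x.fst, x.snd⟩
    | bic x, unit g => bic ⟨x.fst, x.snd + (g : ℤ)⟩
    | bic x, bic y => bic (x * y)
    | bic x, zer m => zer (m + x.snd - x.fst)
    | zer m, bic x => zer (m + x.snd - x.fst)
    | zer m, zer l => zer (m + l)
    | unit g, zer m => zer ((g : ℤ) + m)
    | zer m, unit g => zer ((g : ℤ) + m)

theorem unit_mul_unit (g h : G₁ k) : (unit g * unit h : S₅ k n) = unit (g + h) := rfl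

theorem unit_mul_bic (g : G₁ k) (x : ExtBicyclic) :
    (unit g * bic x : S₅ k n) = bic ⟨-(g : ℤ) + x.fst, x.snd⟩ := rfl

theorem bic_mul_unit (x : ExtBicyclic) (g : G₁ k) :
    (bic x * unit g : S₅ k n) = bic ⟨x.fst, x.snd + (g : ℤ)⟩ := rfl

theorem bic_mul_bic (x y : ExtBicyclic) : (bic x * bic y : S₅ k n) = bic (x * y) := rfl

theorem bic_mul_zer (x : ExtBicyclic) (m : ℤ) :
    (bic x * zer m : S₅ k n) = zer (m + x.snd - x.fst) := rfl

theorem zer_mul_bic (m : ℤ) (x : ExtBicyclic) :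
    (zer m * bic x : S₅ k n) = zer (m + x.snd - x.fst) := rfl

theorem zer_mul_zer (m l : ℤ) : (zer m * zer l : S₅ k n) = zer (m + l) := rfl

theorem unit_mul_zer (g : G₁ k) (m : ℤ) :
    (unit g * zer m : S₅ k n) = zer ((g : ℤ) + m) := rfl

theorem zer_mul_unit (m : ℤ) (g : G₁ k) :
    (zer m * unit g : S₅ k n) = zer ((g : ℤ) + m) := rfl

instance : Monoid (S₅ k n) where
  mul_assoc := by
    rintro (g | x | m) (h | y | l) (t | z | p) <;>
      simp only [unit_mul_unit, unit_mul_bic, bic_mul_unit, bic_mul_bic, bic_mul_zer,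
        zer_mul_bic, zer_mul_zer, unit_mul_zer, zer_mul_unit, ExtBicyclic.mul_def,
        bic.injEq, zer.injEq, AddSubgroup.coe_add, add_assoc] <;> grind
  one := unit 0
  one_mul := by
    rintro (g | x | m)
    · exact congrArg unit (zero_add g)
    · exact congrArg bic (by ext <;> simp)
    · exact congrArg zer (by simp)
  mul_one := by
    rintro (g | x | m)
    · exact congrArg unit (add_zero g)
    · exact congrArg bic (by ext <;> simp)
    · exact congrArg zer (by simp)

/-- The inclusion of `S₂` in `S₅`. -/
def ofS₂ : S₂ k n → S₅ k n
  | .unit g => unit g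
  | .bic x => bic x

/-- The inclusion of `S₃` in `S₅`. -/
def ofS₃ : S₃ → S₅ k n
  | .bic x => bic x
  | .zer m => zer m

/-- The topology `τ₅`, generated by the family `τ₂ ∪ τ₃`. -/
instance : TopologicalSpace (S₅ k n) :=
  TopologicalSpace.generateFrom
    ({W | ∃ U : Set (S₂ k n), IsOpen U ∧ W = ofS₂ '' U} ∪
      {W | ∃ U : Set S₃, IsOpen U ∧ W = ofS₃ '' U})

end S₅

/-! Every point of the extended bicyclic semigroup is isolated in `T`, so a closed relation that
holds for the bicyclic points of an open set holds on the whole open set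
(`mem_of_isClosed_of_isOpen`). Questions about `T` thus become integer arithmetic with pairs.

Compactness of `K` forces (i,i) → 1 as i → -∞. Then a point outside the bicyclic part is either a
unit or is fixed by every (a,a) on both sides (`mem_range_or_isUnit_or_absorbsDiag`).

A unit permutes the isolated points and acts on them as a shift; the shifts form a nonzero subgroup
kℤ. Every (i,i) with i ≤ j lies in `K`, so no diagonal point is skipped near 1; hence n = 1, and
translation carries this to all units.

If absorbing points exist, they form an ideal that is a group, with one idempotent e commuting with
all of `T`. Its elements e·(0,m) give a homomorphic image of ℤ. The crux is that this image is
infinite and discrete: local compactness rules out accumulation at e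
(`IsBottom.finite_kernelPoint_mem_of_nonneg`). A discrete subgroup is closed, so it is the whole
ideal, and T ≅ S₅. If there are none, T ≅ S₂. -/

open Filter Set

/-! ### Bicyclic arithmetic and inverses -/

namespace ExtBicyclic

theorem mk_mul_mk (a b c d : ℤ) :
    (⟨a, b⟩ * ⟨c, d⟩ : ExtBicyclic) = ⟨a + max b c - b, d + max b c - c⟩ := by
  rw [mul_def]
  ext <;> grind

end ExtBicyclic

open ExtBicyclic

section Inversion

variable {S : Type*} [Semigroup S] [IsInverseSemigroup S]

theorem mul_inversion_mul (x : S) : x * inversion S x * x = x :=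
  (IsInverseSemigroup.existsUnique_inverse x).choose_spec.1.1

theorem inversion_mul_inversion (x : S) : inversion S x * x * inversion S x = inversion S x :=
  (IsInverseSemigroup.existsUnique_inverse x).choose_spec.1.2

theorem eq_inversion {x y : S} (h₁ : x * y * x = x) (h₂ : y * x * y = y) : y = inversion S x :=
  (IsInverseSemigroup.existsUnique_inverse x).choose_spec.2 y ⟨h₁, h₂⟩

theorem inversion_inversion (x : S) : inversion S (inversion S x) = x :=
  (eq_inversion (inversion_mul_inversion x) (mul_inversion_mul x)).symm

theorem inversion_of_mul_self {x : S} (h : x * x = x) : inversion S x = x :=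
  (eq_inversion (by rw [h, h]) (by rw [h, h])).symm

theorem inversion_map (ι : ExtBicyclic →ₙ* S) (a b : ℤ) :
    inversion S (ι ⟨a, b⟩) = ι ⟨b, a⟩ := by
  refine (eq_inversion ?_ ?_).symm <;> simp [← map_mul, mk_mul_mk]

end Inversion

theorem IsCompact.finite_of_isOpen_singleton {X : Type*} [TopologicalSpace X] {s : Set X}
    (hs : IsCompact s) (h : ∀ x ∈ s, IsOpen ({x} : Set X)) : s.Finite := by
  obtain ⟨t, -, ht, hst⟩ := hs.elim_finite_subcover_image (b := s) (c := fun x => {x}) h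
    (fun x hx => mem_biUnion hx rfl)
  exact (ht.biUnion fun _ _ => finite_singleton _).subset hst

/-! ### Density arguments and isolated points -/

section Closure

variable {T : Type*} [Monoid T] [TopologicalSpace T] {ι : ExtBicyclic →ₙ* T}

theorem mem_closure_image_preimage (hd : DenseRange ι) {V : Set T} (hV : IsOpen V) {x : T}
    (hx : x ∈ V) : x ∈ closure (ι '' (ι ⁻¹' V)) := by
  rw [image_preimage_eq_inter_range]
  exact hd.open_subset_closure_inter hV hx

theorem mem_of_isClosed_of_isOpen (hd : DenseRange ι) {V F : Set T} (hV : IsOpen V)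
    (hF : IsClosed F) {x : T} (hx : x ∈ V) (h : ∀ a b, ι ⟨a, b⟩ ∈ V → ι ⟨a, b⟩ ∈ F) : x ∈ F := by
  refine closure_minimal ?_ hF (mem_closure_image_preimage hd hV hx)
  rintro _ ⟨⟨a, b⟩, hp, rfl⟩
  exact h a b hp

variable [T2Space T] [IsTopologicalInverseSemigroup T]

omit [T2Space T] in
theorem continuous_inversion : Continuous (inversion T) :=
  IsTopologicalInverseSemigroup.continuous_inversion

/-- The conditions are inequations, hence open. For x = (c,d), both coordinates of (a,a)x(a,a) are
at least a; the first two inequations make them equal to a, so c = d ≤ a, and the third excludes c <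
a. -/
theorem isOpen_singleton_diag (hι : Function.Injective ι) (hd : DenseRange ι) (a : ℤ) :
    IsOpen ({ι ⟨a, a⟩} : Set T) := by
  set V : Set T := {x | ι ⟨a + 1, a + 1⟩ * (ι ⟨a, a⟩ * x * ι ⟨a, a⟩) ≠ ι ⟨a, a⟩ * x * ι ⟨a, a⟩} ∩
    {x | ι ⟨a, a⟩ * x * ι ⟨a, a⟩ * ι ⟨a + 1, a + 1⟩ ≠ ι ⟨a, a⟩ * x * ι ⟨a, a⟩} ∩
    {x | ι ⟨a - 1, a - 1⟩ * x ≠ ι ⟨a - 1, a - 1⟩} with hVdef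
  have hV : IsOpen V := by
    refine IsOpen.inter (IsOpen.inter ?_ ?_) ?_ <;>
      exact isOpen_ne_fun (by fun_prop) (by fun_prop)
  have hmem : ι ⟨a, a⟩ ∈ V := by
    simp only [hVdef, mem_inter_iff, mem_ofPred_eq, ← map_mul, mk_mul_mk, ne_eq, hι.eq_iff,
      ExtBicyclic.mk.injEq]
    omega
  convert hV
  refine Subset.antisymm (singleton_subset_iff.2 hmem) fun x hx => ?_
  refine mem_of_isClosed_of_isOpen hd hV isClosed_singleton hx fun c d h => ?_
  simp only [hVdef, mem_inter_iff, mem_ofPred_eq, ← map_mul, mk_mul_mk, ne_eq, hι.eq_iff,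
      ExtBicyclic.mk.injEq, mem_singleton_iff] at h ⊢
  omega

theorem isOpen_singleton_map (hι : Function.Injective ι) (hd : DenseRange ι) (p : ExtBicyclic) :
    IsOpen ({ι p} : Set T) := by
  obtain ⟨a, b⟩ := p
  -- The first condition leaves the points (a-t, b-t) with t ≥ 0; the second removes t ≥ 1.
  set V : Set T := {x | ι ⟨b, a⟩ * x ∈ ({ι ⟨b, b⟩} : Set T)} ∩
    {x | ι ⟨a - 1, a - 1⟩ * x ≠ ι ⟨a - 1, b - 1⟩} with hVdef
  have hV : IsOpen V := by
    refine IsOpen.inter ((isOpen_singleton_diag hι hd b).preimage (by fun_prop)) ?_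
    exact isOpen_ne_fun (by fun_prop) (by fun_prop)
  have hmem : ι ⟨a, b⟩ ∈ V := by
    simp only [hVdef, mem_inter_iff, mem_ofPred_eq, ← map_mul, mk_mul_mk, ne_eq, hι.eq_iff,
      ExtBicyclic.mk.injEq, mem_singleton_iff]
    omega
  convert hV
  refine Subset.antisymm (singleton_subset_iff.2 hmem) fun x hx => ?_
  refine mem_of_isClosed_of_isOpen hd hV isClosed_singleton hx fun c d h => ?_
  simp only [hVdef, mem_inter_iff, mem_ofPred_eq, ← map_mul, mk_mul_mk, ne_eq, hι.eq_iff,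
      ExtBicyclic.mk.injEq, mem_singleton_iff] at h ⊢
  omega

omit [T2Space T] [IsTopologicalInverseSemigroup T] in
theorem mem_range_of_isOpen_singleton (hd : DenseRange ι) {x : T} (hx : IsOpen ({x} : Set T)) :
    x ∈ range ι := by
  obtain ⟨p, hp⟩ := hd.exists_mem_open hx ⟨x, rfl⟩
  exact ⟨p, hp⟩

omit [TopologicalSpace T] [T2Space T] [IsTopologicalInverseSemigroup T] in
theorem not_isUnit_map (hι : Function.Injective ι) (p : ExtBicyclic) : ¬ IsUnit (ι p) := by
  obtain ⟨a, b⟩ := p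
  intro h
  have h1 : ι ⟨a, a⟩ = 1 := by
    refine h.mul_right_cancel ?_
    simp [← map_mul, mk_mul_mk]
  have h2 : ι ⟨a, a⟩ * ι ⟨a - 1, a - 1⟩ = ι ⟨a - 1, a - 1⟩ := by rw [h1, one_mul]
  simp only [← map_mul, mk_mul_mk, hι.eq_iff, ExtBicyclic.mk.injEq] at h2
  omega

/-- Since (a,a) is isolated, some bicyclic (c,d) near z has z·(d,c) = (a,a), so z·(d,d) is bicyclic.
A bicyclic y is determined by y y⁻¹ and y·(d,d), and fixing both is an open condition, so z is the
only such y. -/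
theorem exists_map_eq_of_mul_inversion (hι : Function.Injective ι) (hd : DenseRange ι) {z : T}
    {a : ℤ} (hz : z * inversion T z = ι ⟨a, a⟩) : z ∈ range ι := by
  have hc := continuous_inversion (T := T)
  obtain ⟨⟨c, d⟩, hp⟩ := hd.exists_mem_open
    ((isOpen_singleton_diag hι hd a).preimage (f := fun y => z * inversion T y) (by fun_prop))
    ⟨z, hz⟩
  have hq : z * ι ⟨d, d⟩ = ι (⟨a, a⟩ * ⟨c, d⟩) := by
    have : z * ι ⟨d, c⟩ = ι ⟨a, a⟩ := by simpa [inversion_map] using hp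
    rw [map_mul, ← this, mul_assoc, ← map_mul, mk_mul_mk]
    simp
  set q := (⟨a, a⟩ * ⟨c, d⟩ : ExtBicyclic)
  set V : Set T := (fun y => y * inversion T y) ⁻¹' {ι ⟨a, a⟩} ∩
    (fun y => y * ι ⟨d, d⟩) ⁻¹' {ι q} with hVdef
  have hV : IsOpen V := ((isOpen_singleton_map hι hd _).preimage (by fun_prop)).inter
    ((isOpen_singleton_map hι hd _).preimage (by fun_prop))
  have hzV : z ∈ V := ⟨hz, hq⟩
  obtain ⟨⟨s, t⟩, hst⟩ := hd.exists_mem_open hV ⟨z, hzV⟩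
  refine ⟨⟨s, t⟩, Eq.symm ?_⟩
  refine mem_of_isClosed_of_isOpen hd hV isClosed_singleton hzV fun s' t' h => ?_
  have h1 := h.1.trans hst.1.symm
  have h2 : ι ⟨s', t'⟩ * ι ⟨d, d⟩ = ι ⟨s, t⟩ * ι ⟨d, d⟩ := h.2.trans hst.2.symm
  simp only [inversion_map, ← map_mul, mk_mul_mk, hι.eq_iff, ExtBicyclic.mk.injEq,
    mem_singleton_iff] at h1 h2 ⊢
  omega

theorem exists_map_eq_of_inversion_mul (hι : Function.Injective ι) (hd : DenseRange ι) {z : T}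
    {a : ℤ} (hz : inversion T z * z = ι ⟨a, a⟩) : z ∈ range ι := by
  obtain ⟨⟨c, d⟩, h⟩ := exists_map_eq_of_mul_inversion hι hd (z := inversion T z) (a := a)
    (by rwa [inversion_inversion])
  exact ⟨⟨d, c⟩, by rw [← inversion_map, h, inversion_inversion]⟩

end Closure

/-! ### Bicyclic points, units and absorbing points -/

section Trichotomy

variable {T : Type*} [Monoid T] [TopologicalSpace T] [T2Space T]
  [IsTopologicalInverseSemigroup T] {ι : ExtBicyclic →ₙ* T}

/-- What `K` leaves outside a neighbourhood of 1 is compact and consists of isolated points, hence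
is finite. -/
theorem tendsto_diag_atBot (hι : Function.Injective ι) (hd : DenseRange ι) {j : ℤ}
    (hK : IsCompact ({(1 : T)} ∪ {x : T | ∃ i : ℤ, i ≤ j ∧ x = ι ⟨i, i⟩})) :
    Tendsto (fun i : ℤ => ι ⟨i, i⟩) atBot (𝓝 1) := by
  rw [tendsto_nhds]
  intro U hU h1
  have hfin : (({(1 : T)} ∪ {x : T | ∃ i : ℤ, i ≤ j ∧ x = ι ⟨i, i⟩}) \ U).Finite := by
    refine (hK.diff hU).finite_of_isOpen_singleton ?_
    rintro x ⟨rfl | ⟨i, -, rfl⟩, hx⟩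
    · exact absurd h1 hx
    · exact isOpen_singleton_map hι hd _
  have hinj : Function.Injective (fun i : ℤ => ι ⟨i, i⟩) := fun a b h => by
    simpa [hι.eq_iff] using h
  have hev := (hfin.preimage hinj.injOn).compl_mem_cofinite
  rw [Int.cofinite_eq] at hev
  filter_upwards [(mem_sup.1 hev).1, eventually_le_atBot j] with i hi hij
  by_contra hiU
  exact hi ⟨Or.inr ⟨i, hij, rfl⟩, hiU⟩

theorem isOpen_one_union_diag (hι : Function.Injective ι) (hd : DenseRange ι) {j : ℤ}
    (hK : IsCompact ({(1 : T)} ∪ {x : T | ∃ i : ℤ, i ≤ j ∧ x = ι ⟨i, i⟩})) {i : ℤ} (hij : i ≤ j) :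
    IsOpen ({(1 : T)} ∪ {x : T | ∃ s : ℤ, s ≤ i ∧ x = ι ⟨s, s⟩}) := by
  convert (isOpen_singleton_map hι hd ⟨i, i⟩).preimage
    (f := fun x => ι ⟨i, i⟩ * x * ι ⟨i, i⟩) (by fun_prop) using 1
  ext x
  constructor
  · rintro (rfl | ⟨s, hs, rfl⟩) <;>
      simp only [mem_preimage, mul_one, ← map_mul, mk_mul_mk, hι.eq_iff, ExtBicyclic.mk.injEq,
        mem_singleton_iff] <;> omega
  · intro hx
    rcases mem_of_isClosed_of_isOpen hd ((isOpen_singleton_map hι hd ⟨i, i⟩).preimage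
      (f := fun x => ι ⟨i, i⟩ * x * ι ⟨i, i⟩) (by fun_prop)) hK.isClosed hx fun c d h => by
        simp only [mem_preimage, ← map_mul, mk_mul_mk, hι.eq_iff, ExtBicyclic.mk.injEq,
          mem_singleton_iff] at h
        exact Or.inr ⟨c, by omega, by rw [show d = c by omega]⟩ with rfl | ⟨s, -, rfl⟩
    · exact Or.inl rfl
    · simp only [mem_preimage, ← map_mul, mk_mul_mk, hι.eq_iff, ExtBicyclic.mk.injEq,
          mem_singleton_iff] at hx
      exact Or.inr ⟨s, by omega, rfl⟩

/-- Bicyclic points near x have the form (u-t, v-t) with t ≥ 0. As x is not bicyclic, finitely many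
t may be discarded; the remaining ones have second coordinate below s, which determines x·(s,s).
Letting s → -∞ exhibits x and x⁻¹ as limits whose products tend to 1. -/
theorem isUnit_of_diag_mul_mul_diag (hι : Function.Injective ι) (hd : DenseRange ι)
    (h1 : Tendsto (fun i : ℤ => ι ⟨i, i⟩) atBot (𝓝 1)) {x : T} (hx : x ∉ range ι) {a : ℤ}
    (h : ι ⟨a, a⟩ * x * ι ⟨a, a⟩ ∈ range ι) : IsUnit x := by
  obtain ⟨⟨u, v⟩, huv⟩ := h
  have hc := continuous_inversion (T := T)
  have hs : ∀ s : ℤ, x * ι ⟨s, s⟩ = ι ⟨s + u - v, s⟩ := by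
    intro s
    set V : Set T := (fun y => ι ⟨a, a⟩ * y * ι ⟨a, a⟩) ⁻¹' {ι ⟨u, v⟩} ∩
      (ι '' {p | ∃ t : ℤ, 0 ≤ t ∧ t ≤ v - s ∧ p = ⟨u - t, v - t⟩})ᶜ with hVdef
    have hfin : {p : ExtBicyclic | ∃ t : ℤ, 0 ≤ t ∧ t ≤ v - s ∧ p = ⟨u - t, v - t⟩}.Finite := by
      refine ((finite_Icc 0 (v - s)).image (fun t : ℤ => (⟨u - t, v - t⟩ : ExtBicyclic))).subset ?_
      rintro p ⟨t, h0, h1, rfl⟩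
      exact ⟨t, ⟨h0, h1⟩, rfl⟩
    have hV : IsOpen V := by
      refine ((isOpen_singleton_map hι hd _).preimage (by fun_prop)).inter ?_
      exact (hfin.image _).isClosed.isOpen_compl
    refine mem_of_isClosed_of_isOpen (F := {y | y * ι ⟨s, s⟩ = ι ⟨s + u - v, s⟩}) hd hV
      (isClosed_eq (by fun_prop) (by fun_prop)) (x := x)
      ⟨huv.symm, fun h => hx (image_subset_range _ _ h)⟩ ?_
    rintro c d ⟨h2, h3⟩
    have h4 : ¬ ∃ t : ℤ, 0 ≤ t ∧ t ≤ v - s ∧ (⟨c, d⟩ : ExtBicyclic) = ⟨u - t, v - t⟩ :=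
      fun h => h3 ⟨_, h, rfl⟩
    have h5 := not_exists.1 h4 (v - d)
    simp only [mem_preimage, ← map_mul, mk_mul_mk, hι.eq_iff, ExtBicyclic.mk.injEq,
      mem_singleton_iff, mem_ofPred_eq] at h2 h5 ⊢
    omega
  have hx1 : Tendsto (fun s : ℤ => ι ⟨s + u - v, s⟩) atBot (𝓝 x) := by
    have := h1.const_mul x
    simpa [hs] using this
  have hx2 : Tendsto (fun s : ℤ => ι ⟨s, s + u - v⟩) atBot (𝓝 (inversion T x)) := by
    have := (hc.tendsto x).comp hx1
    simpa [Function.comp_def, inversion_map] using this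
  have e1 : x * inversion T x = 1 := by
    have h3 : Tendsto (fun s : ℤ => s + (u - v)) atBot atBot :=
      tendsto_atBot_add_const_right _ _ tendsto_id
    refine tendsto_nhds_unique (hx1.mul hx2) ((h1.comp h3).congr fun s => ?_)
    simp [← map_mul, mk_mul_mk, add_sub_assoc]
  have e2 : inversion T x * x = 1 := by
    refine tendsto_nhds_unique (hx2.mul hx1) (h1.congr fun s => ?_)
    simp [← map_mul, mk_mul_mk]
  exact ⟨⟨x, _, e1, e2⟩, rfl⟩

/-- The element `x` is fixed by multiplication by every idempotent of the image of `ι`. -/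
def AbsorbsDiag (ι : ExtBicyclic →ₙ* T) (x : T) : Prop :=
  ∀ a : ℤ, ι ⟨a, a⟩ * x = x ∧ x * ι ⟨a, a⟩ = x

theorem mem_range_or_isUnit_or_absorbsDiag (hι : Function.Injective ι) (hd : DenseRange ι)
    (h1 : Tendsto (fun i : ℤ => ι ⟨i, i⟩) atBot (𝓝 1)) (x : T) :
    x ∈ range ι ∨ IsUnit x ∨ AbsorbsDiag ι x := by
  by_cases hx : x ∈ range ι
  · exact Or.inl hx
  by_cases hu : IsUnit x
  · exact Or.inr (Or.inl hu)
  have hc := continuous_inversion (T := T)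
  refine Or.inr (Or.inr fun a => ⟨?_, ?_⟩)
  · by_contra hne
    -- A bicyclic (c,d) moved by (a,a) on the left has c < a, so the product has first coordinate a.
    have hz : ι ⟨a, a⟩ * x * inversion T (ι ⟨a, a⟩ * x) = ι ⟨a, a⟩ := by
      refine mem_of_isClosed_of_isOpen
        (F := {x | ι ⟨a, a⟩ * x * inversion T (ι ⟨a, a⟩ * x) = ι ⟨a, a⟩})
        (V := {x | ι ⟨a, a⟩ * x ≠ x}) hd (isOpen_ne_fun (by fun_prop) (by fun_prop))
        (isClosed_eq (by fun_prop) (by fun_prop)) hne fun c d h => ?_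
      simp only [inversion_map, ← map_mul, mk_mul_mk, ne_eq, hι.eq_iff, ExtBicyclic.mk.injEq,
        mem_ofPred_eq] at h ⊢
      omega
    obtain ⟨p, hp⟩ := exists_map_eq_of_mul_inversion hι hd hz
    exact hu (isUnit_of_diag_mul_mul_diag hι hd h1 hx ⟨p * ⟨a, a⟩, by rw [map_mul, hp]⟩)
  · by_contra hne
    have hz : inversion T (x * ι ⟨a, a⟩) * (x * ι ⟨a, a⟩) = ι ⟨a, a⟩ := by
      refine mem_of_isClosed_of_isOpen
        (F := {x | inversion T (x * ι ⟨a, a⟩) * (x * ι ⟨a, a⟩) = ι ⟨a, a⟩})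
        (V := {x | x * ι ⟨a, a⟩ ≠ x}) hd (isOpen_ne_fun (by fun_prop) (by fun_prop))
        (isClosed_eq (by fun_prop) (by fun_prop)) hne fun c d h => ?_
      simp only [inversion_map, ← map_mul, mk_mul_mk, ne_eq, hι.eq_iff, ExtBicyclic.mk.injEq,
        mem_ofPred_eq] at h ⊢
      omega
    obtain ⟨p, hp⟩ := exists_map_eq_of_inversion_mul hι hd hz
    exact hu (isUnit_of_diag_mul_mul_diag hι hd h1 hx
      ⟨⟨a, a⟩ * p, by rw [map_mul, hp, mul_assoc]⟩)

omit [TopologicalSpace T] [T2Space T] [IsTopologicalInverseSemigroup T] in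
theorem not_mem_range_of_diag_mul (hι : Function.Injective ι) {x : T}
    (h : ∀ a : ℤ, ι ⟨a, a⟩ * x = x) : x ∉ range ι := by
  rintro ⟨⟨u, v⟩, rfl⟩
  have := h (u + 1)
  simp only [← map_mul, mk_mul_mk, hι.eq_iff, ExtBicyclic.mk.injEq] at this
  omega

omit [TopologicalSpace T] [T2Space T] [IsTopologicalInverseSemigroup T] in
theorem not_mem_range_of_mul_diag (hι : Function.Injective ι) {x : T}
    (h : ∀ a : ℤ, x * ι ⟨a, a⟩ = x) : x ∉ range ι := by
  rintro ⟨⟨u, v⟩, rfl⟩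
  have := h (v + 1)
  simp only [← map_mul, mk_mul_mk, hι.eq_iff, ExtBicyclic.mk.injEq] at this
  omega

omit [TopologicalSpace T] [T2Space T] [IsTopologicalInverseSemigroup T] in
theorem not_isUnit_of_diag_mul (hι : Function.Injective ι) {x : T} {a : ℤ}
    (h : ι ⟨a, a⟩ * x = x) : ¬ IsUnit x := fun hu =>
  not_isUnit_map hι ⟨a, a⟩ (by rw [hu.mul_right_cancel (h.trans (one_mul x).symm)]; exact isUnit_one)

omit [TopologicalSpace T] [T2Space T] [IsTopologicalInverseSemigroup T] in
theorem not_isUnit_of_mul_diag (hι : Function.Injective ι) {x : T} {a : ℤ}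
    (h : x * ι ⟨a, a⟩ = x) : ¬ IsUnit x := fun hu =>
  not_isUnit_map hι ⟨a, a⟩ (by rw [hu.mul_left_cancel (h.trans (mul_one x).symm)]; exact isUnit_one)

/-- Absorption on one side already excludes the other two cases of the trichotomy. This makes the
absorbing points an ideal. -/
theorem absorbsDiag_of_diag_mul (hι : Function.Injective ι) (hd : DenseRange ι)
    (h1 : Tendsto (fun i : ℤ => ι ⟨i, i⟩) atBot (𝓝 1)) {x : T} (h : ∀ a : ℤ, ι ⟨a, a⟩ * x = x) :
    AbsorbsDiag ι x :=
  ((mem_range_or_isUnit_or_absorbsDiag hι hd h1 x).resolve_left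
    (not_mem_range_of_diag_mul hι h)).resolve_left (not_isUnit_of_diag_mul hι (h 0))

theorem absorbsDiag_of_mul_diag (hι : Function.Injective ι) (hd : DenseRange ι)
    (h1 : Tendsto (fun i : ℤ => ι ⟨i, i⟩) atBot (𝓝 1)) {x : T} (h : ∀ a : ℤ, x * ι ⟨a, a⟩ = x) :
    AbsorbsDiag ι x :=
  ((mem_range_or_isUnit_or_absorbsDiag hι hd h1 x).resolve_left
    (not_mem_range_of_mul_diag hι h)).resolve_left (not_isUnit_of_mul_diag hι (h 0))

end Trichotomy

/-! ### The group of units as a group of shifts -/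

section Units

variable {T : Type*} [Monoid T] [TopologicalSpace T] [T2Space T]
  [IsTopologicalInverseSemigroup T] {ι : ExtBicyclic →ₙ* T}

/-- Left multiplication by `x` shifts the first coordinate on the image of `ι` by `-g`. -/
def ShiftsBy (ι : ExtBicyclic →ₙ* T) (x : T) (g : ℤ) : Prop :=
  ∀ a b : ℤ, x * ι ⟨a, b⟩ = ι ⟨-g + a, b⟩

theorem ShiftsBy.eq (hd : DenseRange ι) {x y : T} {g : ℤ} (hx : ShiftsBy ι x g)
    (hy : ShiftsBy ι y g) : x = y := by
  have : (fun t => x * t) = fun t => y * t := by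
    refine hd.equalizer (by fun_prop) (by fun_prop) ?_
    ext ⟨a, b⟩
    exact (hx a b).trans (hy a b).symm
  simpa using congrFun this 1

omit [TopologicalSpace T] [T2Space T] [IsTopologicalInverseSemigroup T] in
theorem ShiftsBy.mul {x y : T} {g h : ℤ} (hx : ShiftsBy ι x g) (hy : ShiftsBy ι y h) :
    ShiftsBy ι (x * y) (g + h) := fun a b => by
  rw [mul_assoc, hy, hx]
  congr 2
  ring

omit [TopologicalSpace T] [T2Space T] [IsTopologicalInverseSemigroup T] in
theorem shiftsBy_one : ShiftsBy ι 1 0 := fun a b => by simp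

omit [TopologicalSpace T] [T2Space T] [IsTopologicalInverseSemigroup T] in
theorem ShiftsBy.inv {x : Tˣ} {g : ℤ} (hx : ShiftsBy ι (x : T) g) :
    ShiftsBy ι ((x⁻¹ : Tˣ) : T) (-g) := fun a b => by
  rw [Units.inv_mul_eq_iff_eq_mul, hx]
  simp

/-- Left multiplication by a unit is a homeomorphism, so it preserves isolated points, and by
density all of these are bicyclic. It also preserves the second coordinate, and compatibility with
(a,a)(b,b) = (b,b) for a ≤ b makes the displacement constant. -/
theorem exists_shiftsBy (hι : Function.Injective ι) (hd : DenseRange ι) (x : Tˣ) :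
    ∃ g, ShiftsBy ι (x : T) g := by
  have hr : ∀ (y : Tˣ) (p : ExtBicyclic), (y : T) * ι p ∈ range ι := by
    intro y p
    refine mem_range_of_isOpen_singleton hd ?_
    convert (isOpen_singleton_map hι hd p).preimage
      (f := fun t => ((y⁻¹ : Tˣ) : T) * t) (by fun_prop) using 1
    ext t
    simp [Units.inv_mul_eq_iff_eq_mul]
  have hdiag : ∀ a, ∃ c, (x : T) * ι ⟨a, a⟩ = ι ⟨c, a⟩ := by
    intro a
    obtain ⟨⟨c, d⟩, h⟩ := hr x ⟨a, a⟩
    have e1 : ι ⟨c, d⟩ * ι ⟨a, a⟩ = ι ⟨c, d⟩ := by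
      rw [h, mul_assoc, ← map_mul, mk_mul_mk]
      simp
    have e2 : ι ⟨a, a⟩ * ι ⟨d, d⟩ = ι ⟨a, a⟩ := by
      rw [← Units.mul_right_inj x, ← mul_assoc, ← h, ← map_mul, mk_mul_mk]
      simp
    simp only [← map_mul, mk_mul_mk, hι.eq_iff, ExtBicyclic.mk.injEq] at e1 e2
    exact ⟨c, by rw [← h, show d = a by omega]⟩
  choose c hc using hdiag
  have hstep : ∀ a b, a ≤ b → c b = c a + b - a := by
    intro a b hab
    have h := hc b
    rw [show (⟨b, b⟩ : ExtBicyclic) = ⟨a, a⟩ * ⟨b, b⟩ by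
      rw [mk_mul_mk]; ext <;> simp [hab], map_mul, ← mul_assoc, hc, ← map_mul, mk_mul_mk,
      hι.eq_iff, ExtBicyclic.mk.injEq] at h
    omega
  refine ⟨-c 0, fun a b => ?_⟩
  have : (⟨a, b⟩ : ExtBicyclic) = ⟨a, a⟩ * ⟨a, b⟩ := by rw [mk_mul_mk]; ext <;> simp
  rw [this, map_mul, ← mul_assoc, hc, ← map_mul, mk_mul_mk]
  congr 1
  ext
  · rcases le_total a 0 with h | h <;> have := hstep _ _ h <;> simp <;> omega
  · simp

theorem ShiftsBy.map_mul_unit (hd : DenseRange ι) {x : Tˣ} {g : ℤ}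
    (hx : ShiftsBy ι (x : T) g) (a b : ℤ) : ι ⟨a, b⟩ * (x : T) = ι ⟨a, b + g⟩ := by
  have : ι ⟨a, b⟩ * (x : T) = ι ⟨a, b + g⟩ * ((1 : Tˣ) : T) := by
    have : (fun t => ι ⟨a, b⟩ * (x : T) * t) = fun t => ι ⟨a, b + g⟩ * t := by
      refine hd.equalizer (by fun_prop) (by fun_prop) ?_
      ext ⟨c, d⟩
      simp only [Function.comp_apply]
      rw [mul_assoc, hx, ← map_mul, ← map_mul, mk_mul_mk, mk_mul_mk]
      congr 2 <;> omega
    simpa using congrFun this 1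
  simpa using this

theorem exists_units_shiftsBy [Nontrivial Tˣ] (hι : Function.Injective ι) (hd : DenseRange ι) :
    ∃ k : ℕ, 0 < k ∧ (∀ x : Tˣ, ∃ g : G₁ k, ShiftsBy ι (x : T) g) ∧
      ∃ u : G₁ k → Tˣ, ∀ g, ShiftsBy ι (u g : T) g := by
  let H : AddSubgroup ℤ :=
    { carrier := {g | ∃ x : Tˣ, ShiftsBy ι (x : T) g}
      add_mem' := by
        rintro a b ⟨x, hx⟩ ⟨y, hy⟩
        exact ⟨x * y, by rw [Units.val_mul]; exact hx.mul hy⟩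
      zero_mem' := ⟨1, shiftsBy_one⟩
      neg_mem' := by
        rintro a ⟨x, hx⟩
        exact ⟨x⁻¹, hx.inv⟩ }
  obtain ⟨k, hk⟩ := Int.subgroup_cyclic H
  have hH : H = AddSubgroup.zmultiples ((k.natAbs : ℕ) : ℤ) := by
    rw [Int.zmultiples_natAbs, hk, AddSubgroup.zmultiples_eq_closure]
  have hall : ∀ x : Tˣ, ∃ g : G₁ k.natAbs, ShiftsBy ι (x : T) g := by
    intro x
    obtain ⟨g, hg⟩ := exists_shiftsBy hι hd x
    exact ⟨⟨g, hH ▸ ⟨x, hg⟩⟩, hg⟩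
  refine ⟨k.natAbs, Nat.pos_of_ne_zero fun h0 => ?_, hall, ?_⟩
  · obtain ⟨x, hx⟩ := exists_ne (1 : Tˣ)
    obtain ⟨⟨g, hg⟩, hs⟩ := hall x
    have hg0 : g = 0 := by simpa [h0] using hg
    subst hg0
    -- A unit with shift 0 agrees with 1 on a dense set, so k = 0 would make the unit group trivial.
    exact hx (Units.ext (hs.eq hd shiftsBy_one))
  · have : ∀ g : G₁ k.natAbs, ∃ x : Tˣ, ShiftsBy ι (x : T) g := by
      rintro ⟨g, hg⟩
      rw [← hH] at hg
      exact hg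
    choose u hu using this
    exact ⟨u, hu⟩

end Units

/-! ### The ideal of absorbing points -/

section Kernel

variable {T : Type*} [Monoid T] [TopologicalSpace T] [T2Space T]
  [IsTopologicalInverseSemigroup T] {ι : ExtBicyclic →ₙ* T}

theorem AbsorbsDiag.mul_right (hι : Function.Injective ι) (hd : DenseRange ι)
    (h1 : Tendsto (fun i : ℤ => ι ⟨i, i⟩) atBot (𝓝 1)) {x : T} (hx : AbsorbsDiag ι x) (t : T) :
    AbsorbsDiag ι (x * t) :=
  absorbsDiag_of_diag_mul hι hd h1 fun a => by rw [← mul_assoc, (hx a).1]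

theorem AbsorbsDiag.mul_left (hι : Function.Injective ι) (hd : DenseRange ι)
    (h1 : Tendsto (fun i : ℤ => ι ⟨i, i⟩) atBot (𝓝 1)) {x : T} (hx : AbsorbsDiag ι x) (t : T) :
    AbsorbsDiag ι (t * x) :=
  absorbsDiag_of_mul_diag hι hd h1 fun a => by rw [mul_assoc, (hx a).2]

theorem AbsorbsDiag.mul_eq_of_mem_closure {x y : T} (hx : AbsorbsDiag ι x)
    (hy : y ∈ closure (range fun i : ℤ => ι ⟨i, i⟩)) : y * x = x ∧ x * y = x := by
  have hc : IsClosed {y | y * x = x ∧ x * y = x} :=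
    (isClosed_eq (by fun_prop) (by fun_prop)).inter (isClosed_eq (by fun_prop) (by fun_prop))
  refine closure_minimal ?_ hc hy
  rintro _ ⟨i, rfl⟩
  exact hx i

omit [T2Space T] in
-- The map x ↦ x x⁻¹ sends bicyclic points to the diagonal and fixes idempotents.
theorem mem_closure_diag_of_mul_self (hd : DenseRange ι) {x : T} (hx : x * x = x) :
    x ∈ closure (range fun i : ℤ => ι ⟨i, i⟩) := by
  have hc := continuous_inversion (T := T)
  have : x * inversion T x ∈ closure (range fun i : ℤ => ι ⟨i, i⟩) := by
    refine mem_of_isClosed_of_isOpen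
      (F := (fun x => x * inversion T x) ⁻¹' closure (range fun i : ℤ => ι ⟨i, i⟩))
      hd isOpen_univ (isClosed_closure.preimage (by fun_prop)) (mem_univ x) fun a b _ => ?_
    refine subset_closure ⟨a, ?_⟩
    simp [inversion_map, ← map_mul, mk_mul_mk]
  rwa [inversion_of_mul_self hx, hx] at this

/-- `e` is an idempotent below all idempotents of the image of `ι`. -/
structure IsBottom (ι : ExtBicyclic →ₙ* T) (e : T) : Prop where
  absorbs : AbsorbsDiag ι e
  mul_self : e * e = e

theorem exists_isBottom (hι : Function.Injective ι) (hd : DenseRange ι)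
    (h1 : Tendsto (fun i : ℤ => ι ⟨i, i⟩) atBot (𝓝 1)) {x : T} (hx : AbsorbsDiag ι x) :
    ∃ e, IsBottom ι e :=
  ⟨x * inversion T x, hx.mul_right hι hd h1 _, by rw [← mul_assoc, mul_inversion_mul]⟩

variable {e : T}

omit [T2Space T] in
theorem IsBottom.mem_closure (he : IsBottom ι e) (hd : DenseRange ι) :
    e ∈ closure (range fun i : ℤ => ι ⟨i, i⟩) := mem_closure_diag_of_mul_self hd he.mul_self

theorem IsBottom.mul_eq (he : IsBottom ι e) (hd : DenseRange ι) {x : T} (hx : AbsorbsDiag ι x) :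
    e * x = x := (hx.mul_eq_of_mem_closure (he.mem_closure hd)).1

theorem IsBottom.eq_mul (he : IsBottom ι e) (hd : DenseRange ι) {x : T} (hx : AbsorbsDiag ι x) :
    x * e = x := (hx.mul_eq_of_mem_closure (he.mem_closure hd)).2

/-- The product e x equals x because e is a limit of diagonal points, and equals e because x is one.
-/
theorem IsBottom.eq_of_mem_closure (he : IsBottom ι e) (hd : DenseRange ι) {x : T}
    (hx : AbsorbsDiag ι x) (hxc : x ∈ closure (range fun i : ℤ => ι ⟨i, i⟩)) : x = e :=
  (he.mul_eq hd hx).symm.trans (he.absorbs.mul_eq_of_mem_closure hxc).2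

theorem IsBottom.eq_of_mul_self (he : IsBottom ι e) (hd : DenseRange ι) {x : T}
    (hx : AbsorbsDiag ι x) (hxx : x * x = x) : x = e :=
  he.eq_of_mem_closure hd hx (mem_closure_diag_of_mul_self hd hxx)

theorem IsBottom.mul_inversion (he : IsBottom ι e) (hι : Function.Injective ι) (hd : DenseRange ι)
    (h1 : Tendsto (fun i : ℤ => ι ⟨i, i⟩) atBot (𝓝 1)) {x : T} (hx : AbsorbsDiag ι x) :
    x * inversion T x = e :=
  he.eq_of_mul_self hd (hx.mul_right hι hd h1 _) (by rw [← mul_assoc, mul_inversion_mul])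

theorem IsBottom.inversion_mul (he : IsBottom ι e) (hι : Function.Injective ι) (hd : DenseRange ι)
    (h1 : Tendsto (fun i : ℤ => ι ⟨i, i⟩) atBot (𝓝 1)) {x : T} (hx : AbsorbsDiag ι x) :
    inversion T x * x = e :=
  he.eq_of_mul_self hd (hx.mul_left hι hd h1 _) (by rw [← mul_assoc, inversion_mul_inversion])

/-- Both e t and t e are absorbing, so both equal e t e. -/
theorem IsBottom.comm (he : IsBottom ι e) (hι : Function.Injective ι) (hd : DenseRange ι)
    (h1 : Tendsto (fun i : ℤ => ι ⟨i, i⟩) atBot (𝓝 1)) (t : T) : e * t = t * e := by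
  rw [← he.eq_mul hd (he.absorbs.mul_right hι hd h1 t), mul_assoc,
    he.mul_eq hd (he.absorbs.mul_left hι hd h1 t)]

/-- The image of `m` in the kernel with identity `e`. -/
def kernelPoint (ι : ExtBicyclic →ₙ* T) (e : T) (m : ℤ) : T := e * ι ⟨0, m⟩

theorem IsBottom.absorbsDiag_kernelPoint (he : IsBottom ι e) (hι : Function.Injective ι)
    (hd : DenseRange ι) (h1 : Tendsto (fun i : ℤ => ι ⟨i, i⟩) atBot (𝓝 1)) (m : ℤ) :
    AbsorbsDiag ι (kernelPoint ι e m) := he.absorbs.mul_right hι hd h1 _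

omit [TopologicalSpace T] [T2Space T] [IsTopologicalInverseSemigroup T] in
-- Since e = e·(c,c), the pair can be pushed up its diagonal without changing the product.
theorem IsBottom.mul_map (he : IsBottom ι e) (a b : ℤ) :
    e * ι ⟨a, b⟩ = kernelPoint ι e (b - a) := by
  have key : ∀ a b c, a ≤ c → e * ι ⟨a, b⟩ = e * ι ⟨c, c + (b - a)⟩ := by
    intro a b c h
    rw [← (he.absorbs c).2, mul_assoc, ← map_mul, mk_mul_mk, mul_assoc, ← map_mul, mk_mul_mk]
    congr 3 <;> omega
  rw [kernelPoint, key a b (max a 0) (le_max_left _ _), key 0 (b - a) (max a 0) (le_max_right _ _),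
    sub_zero]

omit [TopologicalSpace T] [T2Space T] [IsTopologicalInverseSemigroup T] in
theorem IsBottom.kernelPoint_mul_map (he : IsBottom ι e) (m a b : ℤ) :
    kernelPoint ι e m * ι ⟨a, b⟩ = kernelPoint ι e (m + b - a) := by
  rw [kernelPoint, mul_assoc, ← map_mul, mk_mul_mk, he.mul_map]
  congr 1
  omega

theorem IsBottom.map_mul_kernelPoint (he : IsBottom ι e) (hι : Function.Injective ι)
    (hd : DenseRange ι) (h1 : Tendsto (fun i : ℤ => ι ⟨i, i⟩) atBot (𝓝 1)) (m a b : ℤ) :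
    ι ⟨a, b⟩ * kernelPoint ι e m = kernelPoint ι e (m + b - a) := by
  rw [kernelPoint, ← mul_assoc, ← he.comm hι hd h1, mul_assoc, ← map_mul, mk_mul_mk, he.mul_map]
  congr 1
  omega

theorem IsBottom.kernelPoint_mul_kernelPoint (he : IsBottom ι e) (hι : Function.Injective ι)
    (hd : DenseRange ι) (h1 : Tendsto (fun i : ℤ => ι ⟨i, i⟩) atBot (𝓝 1)) (m l : ℤ) :
    kernelPoint ι e m * kernelPoint ι e l = kernelPoint ι e (m + l) := by
  rw [show kernelPoint ι e l = e * ι ⟨0, l⟩ from rfl, ← mul_assoc,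
    he.eq_mul hd (he.absorbsDiag_kernelPoint hι hd h1 m), he.kernelPoint_mul_map, sub_zero]

omit [TopologicalSpace T] [T2Space T] [IsTopologicalInverseSemigroup T] in
theorem IsBottom.kernelPoint_zero (he : IsBottom ι e) : kernelPoint ι e 0 = e := (he.absorbs 0).2

theorem IsBottom.inversion_kernelPoint (he : IsBottom ι e) (hι : Function.Injective ι)
    (hd : DenseRange ι) (h1 : Tendsto (fun i : ℤ => ι ⟨i, i⟩) atBot (𝓝 1)) (m : ℤ) :
    inversion T (kernelPoint ι e m) = kernelPoint ι e (-m) := by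
  refine (eq_inversion ?_ ?_).symm <;> simp [he.kernelPoint_mul_kernelPoint hι hd h1]

/-- A set of points of the image of `ι` inside a compact set is finite as soon as it only
accumulates at points of the image. -/
theorem finite_of_closure_subset_range (hι : Function.Injective ι) (hd : DenseRange ι) {M X : Set T}
    (hM : IsCompact M) (hX : X ⊆ M) (h : closure X ⊆ range ι) : X.Finite := by
  have hcX : IsCompact (closure X) := hM.of_isClosed_subset isClosed_closure
    (closure_minimal hX hM.isClosed)
  refine (hcX.finite_of_isOpen_singleton fun x hx => ?_).subset subset_closure
  obtain ⟨p, rfl⟩ := h hx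
  exact isOpen_singleton_map hι hd p

theorem IsBottom.frequently_mem (he : IsBottom ι e) (hι : Function.Injective ι) (hd : DenseRange ι)
    {V : Set T} (hV : IsOpen V) (heV : e ∈ V) (a : ℤ) : ∃ c : ℤ, a < c ∧ ι ⟨c, c⟩ ∈ V := by
  have hW : IsOpen (V ∩ {y | ι ⟨a, a⟩ * y ≠ ι ⟨a, a⟩}) :=
    hV.inter (isOpen_ne_fun (by fun_prop) (by fun_prop))
  have heW : e ∈ V ∩ {y | ι ⟨a, a⟩ * y ≠ ι ⟨a, a⟩} := by
    refine ⟨heV, ?_⟩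
    rw [mem_ofPred_eq, (he.absorbs a).1]
    rintro h
    exact not_mem_range_of_diag_mul hι (fun b => (he.absorbs b).1) ⟨_, h.symm⟩
  obtain ⟨_, ⟨h1, h2⟩, c, rfl⟩ := mem_closure_iff.1 (he.mem_closure hd) _ hW heW
  refine ⟨c, ?_, h1⟩
  simp only [← map_mul, mk_mul_mk, ne_eq, hι.eq_iff, ExtBicyclic.mk.injEq, mem_ofPred_eq] at h2
  omega

theorem IsBottom.finite_diag_diff (he : IsBottom ι e) (hι : Function.Injective ι)
    (hd : DenseRange ι) (h1 : Tendsto (fun i : ℤ => ι ⟨i, i⟩) atBot (𝓝 1)) {M V : Set T}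
    (hM : IsCompact M) (hV : IsOpen V) (heV : e ∈ V) :
    {c : ℤ | 0 < c ∧ ι ⟨c, c⟩ ∈ M ∧ ι ⟨c, c⟩ ∉ V}.Finite := by
  have hinj : Function.Injective (fun i : ℤ => ι ⟨i, i⟩) := fun a b h => by
    simpa [hι.eq_iff] using h
  refine Finite.of_finite_image (f := fun i : ℤ => ι ⟨i, i⟩) ?_ hinj.injOn
  refine finite_of_closure_subset_range hι hd hM ?_ fun y hy => ?_
  · rintro _ ⟨c, hc, rfl⟩
    exact hc.2.1
  have hyV : y ∉ V := by
    refine closure_minimal (t := Vᶜ) ?_ hV.isClosed_compl hy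
    rintro _ ⟨c, hc, rfl⟩
    exact hc.2.2
  have hy1 : ι ⟨1, 1⟩ * y = y := by
    refine closure_minimal (t := {y | ι ⟨1, 1⟩ * y = y}) ?_
      (isClosed_eq (by fun_prop) (by fun_prop)) hy
    rintro _ ⟨c, hc, rfl⟩
    have := hc.1
    simp only [← map_mul, mk_mul_mk, hι.eq_iff, ExtBicyclic.mk.injEq, mem_ofPred_eq]
    omega
  have hyd : y ∈ closure (range fun i : ℤ => ι ⟨i, i⟩) :=
    closure_mono (image_subset_range _ _) hy
  rcases mem_range_or_isUnit_or_absorbsDiag hι hd h1 y with h | h | h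
  · exact h
  · exact absurd h (not_isUnit_of_diag_mul hι hy1)
  · exact absurd ((he.eq_of_mem_closure hd h hyd) ▸ heV) hyV

/-- Conjugation y ↦ (1,0)y(0,1) fixes e and sends (n,n) to (n+1,n+1) for n ≥ 0. By
`IsBottom.finite_diag_diff`, all but finitely many positive diagonal points of the compact `M` lie
in the preimage of its interior, so the sequence, once in `M` far enough out, stays there. -/
theorem IsBottom.tendsto_diag_atTop [LocallyCompactSpace T] (he : IsBottom ι e)
    (hι : Function.Injective ι) (hd : DenseRange ι)
    (h1 : Tendsto (fun i : ℤ => ι ⟨i, i⟩) atBot (𝓝 1)) :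
    Tendsto (fun i : ℤ => ι ⟨i, i⟩) atTop (𝓝 e) := by
  intro U hU
  obtain ⟨M, hMe, hMU, hM⟩ := local_compact_nhds hU
  have hψe : ι ⟨1, 0⟩ * e * ι ⟨0, 1⟩ = e := by
    rw [← he.comm hι hd h1, mul_assoc, ← map_mul, mk_mul_mk, he.mul_map]
    simpa using he.kernelPoint_zero
  set V : Set T := (fun y => ι ⟨1, 0⟩ * y * ι ⟨0, 1⟩) ⁻¹' interior M with hVdef
  have hV : IsOpen V := isOpen_interior.preimage (by fun_prop)
  have heV : e ∈ V := by
    rw [hVdef, mem_preimage, hψe]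
    exact mem_interior_iff_mem_nhds.2 hMe
  obtain ⟨C, hC⟩ := (he.finite_diag_diff hι hd h1 hM hV heV).bddAbove
  obtain ⟨c, hCc, hc⟩ := he.frequently_mem hι hd isOpen_interior
    (mem_interior_iff_mem_nhds.2 hMe) (max C 0)
  have hstep : ∀ n, c ≤ n → ι ⟨n, n⟩ ∈ M := by
    intro n hn
    induction n, hn using Int.leInduction with
    | base => exact interior_subset hc
    | succ n hn ih =>
      have hnV : ι ⟨n, n⟩ ∈ V := by
        by_contra hnV
        have := hC ⟨by omega, ih, hnV⟩
        omega
      have := interior_subset hnV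
      simp only [← map_mul, mk_mul_mk] at this
      convert this using 2
      ext <;> simp <;> omega
  rw [mem_map]
  filter_upwards [eventually_ge_atTop c] with n hn using hMU (hstep n hn)

theorem IsBottom.tendsto_kernelPoint [LocallyCompactSpace T] (he : IsBottom ι e)
    (hι : Function.Injective ι) (hd : DenseRange ι)
    (h1 : Tendsto (fun i : ℤ => ι ⟨i, i⟩) atBot (𝓝 1)) (m : ℤ) :
    Tendsto (fun c : ℤ => ι ⟨c, c + m⟩) atTop (𝓝 (kernelPoint ι e m)) := by
  refine ((he.tendsto_diag_atTop hι hd h1).mul_const (ι ⟨0, m⟩)).congr' ?_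
  filter_upwards [eventually_ge_atTop 0] with c hc
  simp only [← map_mul, mk_mul_mk]
  congr 2 <;> omega

/-- The line c ↦ (c,c+m) tends to `kernelPoint ι e m`, so if that limit is in `N'` the line either
starts in `N` or enters it later. Starting points and entry points both form subsets of a compact
set that accumulate only at isolated points, so only finitely many m occur. -/
theorem IsBottom.finite_kernelPoint_mem_of_nonneg [LocallyCompactSpace T] (he : IsBottom ι e)
    (hι : Function.Injective ι) (hd : DenseRange ι)
    (h1 : Tendsto (fun i : ℤ => ι ⟨i, i⟩) atBot (𝓝 1)) {N N' : Set T} (hN : IsCompact N)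
    (hN' : IsClosed N') (hNN : N' ⊆ interior N) :
    {m : ℤ | 0 ≤ m ∧ kernelPoint ι e m ∈ N'}.Finite := by
  have hc := continuous_inversion (T := T)
  -- lines starting inside `N`
  have hfin1 : {m : ℤ | ι ⟨0, m⟩ ∈ N}.Finite := by
    refine Finite.of_finite_image (f := fun m : ℤ => ι ⟨0, m⟩) ?_
      (fun a _ b _ h => by simpa [hι.eq_iff] using h)
    refine finite_of_closure_subset_range hι hd hN ?_ fun y hy => ?_
    · rintro _ ⟨m, hm, rfl⟩
      exact hm
    · refine exists_map_eq_of_mul_inversion hι hd (a := 0) ?_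
      refine closure_minimal (t := {y | y * inversion T y = ι ⟨0, 0⟩}) ?_
        (isClosed_eq (by fun_prop) (by fun_prop)) hy
      rintro _ ⟨m, -, rfl⟩
      simp [inversion_map, ← map_mul, mk_mul_mk]
  -- points where a line enters `N`
  set X : Set T := {x | ∃ c m : ℤ, 0 ≤ c ∧ 0 ≤ m ∧ kernelPoint ι e m ∈ N' ∧ ι ⟨c, c + m⟩ ∉ N ∧
    ι ⟨c + 1, c + 1 + m⟩ ∈ N ∧ x = ι ⟨c + 1, c + 1 + m⟩} with hXdef
  have hX : X.Finite := by
    refine finite_of_closure_subset_range hι hd hN ?_ fun y hy => ?_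
    · rintro _ ⟨c, m, -, -, -, -, h, rfl⟩
      exact h
    rcases mem_range_or_isUnit_or_absorbsDiag hι hd h1 y with h | h | h
    · exact h
    · refine absurd h (not_isUnit_of_diag_mul (a := 0) hι ?_)
      refine closure_minimal (t := {y | ι ⟨0, 0⟩ * y = y}) ?_
        (isClosed_eq (by fun_prop) (by fun_prop)) hy
      rintro _ ⟨c, m, h0, h1, -, -, -, rfl⟩
      simp only [← map_mul, mk_mul_mk, hι.eq_iff, ExtBicyclic.mk.injEq, mem_ofPred_eq]
      omega
    -- An absorbing limit y of entry points is fixed by the conjugation that moves each entry point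
    -- one step back, out of `N`; so y is not interior to `N`. Yet y = e y is a limit of kernel
    -- points in `N'`, a contradiction.
    · have hφ : ι ⟨0, 1⟩ * y * ι ⟨1, 0⟩ = y := by
        have : e * (ι ⟨0, 1⟩ * y * ι ⟨1, 0⟩) = e * y := by
          refine mem_of_isClosed_of_isOpen (F := {y | e * (ι ⟨0, 1⟩ * y * ι ⟨1, 0⟩) = e * y})
            hd isOpen_univ (isClosed_eq (by fun_prop) (by fun_prop)) (mem_univ y) fun a b _ => ?_
          simp only [mem_ofPred_eq, ← map_mul, mk_mul_mk, he.mul_map]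
          congr 1
          omega
        rwa [he.mul_eq hd h, he.mul_eq hd ((h.mul_left hι hd h1 _).mul_right hι hd h1 _)] at this
      have hy1 : ι ⟨0, 1⟩ * y * ι ⟨1, 0⟩ ∉ interior N := by
        refine closure_minimal (t := (fun y => ι ⟨0, 1⟩ * y * ι ⟨1, 0⟩) ⁻¹' (interior N)ᶜ) ?_
          (isOpen_interior.isClosed_compl.preimage (by fun_prop)) hy
        rintro _ ⟨c, m, h0, h1, -, h2, -, rfl⟩
        refine fun h => h2 (interior_subset ?_)
        simp only [← map_mul, mk_mul_mk] at h
        convert h using 2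
        ext <;> simp <;> omega
      have hy2 : e * y ∈ N' := by
        refine closure_minimal (t := (fun y => e * y) ⁻¹' N') ?_
          (hN'.preimage (by fun_prop)) hy
        rintro _ ⟨c, m, h0, h1, h2, -, -, rfl⟩
        rw [mem_preimage, he.mul_map]
        simpa using h2
      rw [he.mul_eq hd h] at hy2
      rw [hφ] at hy1
      exact absurd (hNN hy2) hy1
  have hfin2 : {m : ℤ | ∃ c, ι ⟨c, c + m⟩ ∈ X}.Finite := by
    have : (ι ⁻¹' X).Finite := hX.preimage hι.injOn
    refine (this.image fun p => p.snd - p.fst).subset ?_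
    rintro m ⟨c, hc⟩
    exact ⟨_, hc, by simp⟩
  refine (hfin1.union hfin2).subset ?_
  rintro m ⟨hm, hmN⟩
  by_contra hcon
  rw [mem_union, not_or] at hcon
  have hout : ∀ c : ℤ, 0 ≤ c → ι ⟨c, c + m⟩ ∉ N := by
    intro c h0
    induction c, h0 using Int.leInduction with
    | base => simpa using hcon.1
    | succ c h0 ih => exact fun h => hcon.2 ⟨c + 1, c, m, h0, hm, hmN, ih, h, rfl⟩
  obtain ⟨c, hc1, hc2⟩ := ((he.tendsto_kernelPoint hι hd h1 m).eventually
    (isOpen_interior.mem_nhds (hNN hmN))).and (eventually_ge_atTop 0) |>.exists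
  exact hout c hc2 (interior_subset hc1)

theorem IsBottom.exists_isOpen_finite [LocallyCompactSpace T] (he : IsBottom ι e)
    (hι : Function.Injective ι) (hd : DenseRange ι)
    (h1 : Tendsto (fun i : ℤ => ι ⟨i, i⟩) atBot (𝓝 1)) :
    ∃ O : Set T, IsOpen O ∧ e ∈ O ∧ {m : ℤ | kernelPoint ι e m ∈ O}.Finite := by
  have hc := continuous_inversion (T := T)
  obtain ⟨N, hN, hNe⟩ := exists_compact_mem_nhds e
  obtain ⟨N', hNe', hNN, hN'⟩ := local_compact_nhds (interior_mem_nhds.2 hNe)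
  have hf := he.finite_kernelPoint_mem_of_nonneg hι hd h1 hN hN'.isClosed hNN
  have hei : e ∈ interior N' := mem_interior_iff_mem_nhds.2 hNe'
  refine ⟨interior N' ∩ inversion T ⁻¹' interior N',
    isOpen_interior.inter (isOpen_interior.preimage hc), ⟨hei, ?_⟩, ?_⟩
  · rwa [mem_preimage, inversion_of_mul_self he.mul_self]
  · refine (hf.union (hf.preimage neg_injective.injOn)).subset ?_
    rintro m ⟨h2, h3⟩
    rw [mem_preimage, he.inversion_kernelPoint hι hd h1] at h3
    rcases le_total 0 m with h | h
    · exact Or.inl ⟨h, interior_subset h2⟩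
    · exact Or.inr ⟨by omega, interior_subset h3⟩

/-- A coincidence would send infinitely many integers to e. -/
theorem IsBottom.kernelPoint_injective [LocallyCompactSpace T] (he : IsBottom ι e)
    (hι : Function.Injective ι) (hd : DenseRange ι)
    (h1 : Tendsto (fun i : ℤ => ι ⟨i, i⟩) atBot (𝓝 1)) :
    Function.Injective (kernelPoint ι e) := by
  obtain ⟨O, -, heO, hfin⟩ := he.exists_isOpen_finite hι hd h1
  have hadd := he.kernelPoint_mul_kernelPoint hι hd h1
  intro m l hml
  by_contra hne
  have h0 : kernelPoint ι e (m - l) = e := by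
    rw [sub_eq_add_neg, ← hadd, hml, hadd, add_neg_cancel, he.kernelPoint_zero]
  have hn : ∀ n : ℕ, kernelPoint ι e (n * (m - l)) = e := by
    intro n
    induction n with
    | zero => simpa using he.kernelPoint_zero
    | succ n ih =>
      rw [Nat.cast_succ, add_mul, one_mul, ← hadd, ih, h0, he.mul_self]
  refine infinite_of_injective_forall_mem (f := fun n : ℕ => (n : ℤ) * (m - l)) ?_ ?_ hfin
  · intro a b hab
    exact_mod_cast mul_right_cancel₀ (sub_ne_zero.2 hne) hab
  · intro n
    simpa [hn n] using heO

theorem IsBottom.exists_isOpen_kernelPoint_mem_iff [LocallyCompactSpace T] (he : IsBottom ι e)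
    (hι : Function.Injective ι) (hd : DenseRange ι)
    (h1 : Tendsto (fun i : ℤ => ι ⟨i, i⟩) atBot (𝓝 1)) :
    ∃ O : Set T, IsOpen O ∧ ∀ m, kernelPoint ι e m ∈ O ↔ m = 0 := by
  obtain ⟨O, hO, heO, hfin⟩ := he.exists_isOpen_finite hι hd h1
  refine ⟨O \ (kernelPoint ι e '' ({m : ℤ | kernelPoint ι e m ∈ O} \ {0})),
    hO.sdiff ((hfin.sdiff).image _).isClosed, fun m => ⟨?_, ?_⟩⟩
  · rintro ⟨h2, h3⟩
    by_contra hm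
    exact h3 ⟨m, ⟨h2, hm⟩, rfl⟩
  · rintro rfl
    refine ⟨by rwa [he.kernelPoint_zero], ?_⟩
    rintro ⟨m, ⟨-, hm⟩, h⟩
    exact hm (he.kernelPoint_injective hι hd h1 h)

/-- A kernel point g is chosen so near y that w = g y⁻¹ lies in the open set isolating e among
kernel points. Bicyclic points near w are then diagonal, which forces w = e and y = g. -/
theorem IsBottom.exists_kernelPoint_eq [LocallyCompactSpace T] (he : IsBottom ι e)
    (hι : Function.Injective ι) (hd : DenseRange ι)
    (h1 : Tendsto (fun i : ℤ => ι ⟨i, i⟩) atBot (𝓝 1)) {y : T} (hy : AbsorbsDiag ι y) :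
    ∃ m, kernelPoint ι e m = y := by
  obtain ⟨O, hO, hOm⟩ := he.exists_isOpen_kernelPoint_mem_iff hι hd h1
  have heO : e ∈ O := by simpa [he.kernelPoint_zero] using (hOm 0).2 rfl
  obtain ⟨⟨a, b⟩, hab⟩ := hd.exists_mem_open
    (hO.preimage (f := fun x => e * x * inversion T y) (by fun_prop))
    ⟨y, by rwa [mem_preimage, he.mul_eq hd hy, he.mul_inversion hι hd h1 hy]⟩
  rw [mem_preimage, he.mul_map] at hab
  have hw : AbsorbsDiag ι (kernelPoint ι e (b - a) * inversion T y) :=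
    (he.absorbsDiag_kernelPoint hι hd h1 _).mul_right hι hd h1 _
  have hwe : kernelPoint ι e (b - a) * inversion T y = e := by
    refine he.eq_of_mem_closure hd hw ?_
    refine mem_of_isClosed_of_isOpen hd (hO.preimage (f := fun x => e * x) (by fun_prop))
      isClosed_closure (by rwa [mem_preimage, he.mul_eq hd hw]) fun c d h => subset_closure ⟨c, ?_⟩
    rw [mem_preimage, he.mul_map, hOm] at h
    simp [show d = c by omega]
  refine ⟨b - a, ?_⟩
  have := he.eq_mul hd (he.absorbsDiag_kernelPoint hι hd h1 (b - a))
  rwa [← he.inversion_mul hι hd h1 hy, ← mul_assoc, he.inversion_mul hι hd h1 hy, hwe,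
    he.mul_eq hd hy, eq_comm] at this

theorem IsBottom.kernelPoint_union_mem_nhds [LocallyCompactSpace T] (he : IsBottom ι e)
    (hι : Function.Injective ι) (hd : DenseRange ι)
    (h1 : Tendsto (fun i : ℤ => ι ⟨i, i⟩) atBot (𝓝 1)) (m a : ℤ) :
    {kernelPoint ι e m} ∪ {x | ∃ c : ℤ, a < c ∧ x = ι ⟨c, c + m⟩} ∈ 𝓝 (kernelPoint ι e m) := by
  obtain ⟨O, hO, hOm⟩ := he.exists_isOpen_kernelPoint_mem_iff hι hd h1
  -- The first condition selects the bicyclic points (c,c+m), the second those with c > a.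
  set V : Set T := (fun x => e * x * kernelPoint ι e (-m)) ⁻¹' O ∩
    {x | ι ⟨a, a⟩ * x ≠ ι ⟨a, a + m⟩} with hVdef
  have hV : IsOpen V :=
    (hO.preimage (by fun_prop)).inter (isOpen_ne_fun (by fun_prop) (by fun_prop))
  have habs := he.absorbsDiag_kernelPoint hι hd h1 m
  have hadd := he.kernelPoint_mul_kernelPoint hι hd h1
  have hVm : ∀ c d, ι ⟨c, d⟩ ∈ V → a < c ∧ d = c + m := by
    rintro c d ⟨h2, h3⟩
    rw [mem_preimage, he.mul_map, hadd, hOm] at h2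
    simp only [← map_mul, mk_mul_mk, ne_eq, hι.eq_iff, ExtBicyclic.mk.injEq, mem_ofPred_eq] at h3
    omega
  refine mem_of_superset (hV.mem_nhds ⟨?_, ?_⟩) fun x hx => ?_
  · rw [mem_preimage, he.mul_eq hd habs, hadd, hOm, add_neg_cancel]
  · rw [mem_ofPred_eq, (habs a).1]
    exact fun h => not_mem_range_of_diag_mul hι (fun b => (habs b).1) ⟨_, h.symm⟩
  · rcases mem_range_or_isUnit_or_absorbsDiag hι hd h1 x with ⟨⟨c, d⟩, rfl⟩ | h | h
    · obtain ⟨h2, rfl⟩ := hVm c d hx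
      exact Or.inr ⟨c, h2, rfl⟩
    · refine absurd h (not_isUnit_of_diag_mul (a := a) hι ?_)
      refine mem_of_isClosed_of_isOpen (F := {x | ι ⟨a, a⟩ * x = x}) hd hV
        (isClosed_eq (by fun_prop) (by fun_prop)) hx fun c d h => ?_
      have := hVm c d h
      simp only [← map_mul, mk_mul_mk, hι.eq_iff, ExtBicyclic.mk.injEq, mem_ofPred_eq]
      omega
    · have : e * x = kernelPoint ι e m := by
        refine mem_of_isClosed_of_isOpen (F := {x | e * x = kernelPoint ι e m}) hd hV
          (isClosed_eq (by fun_prop) (by fun_prop)) hx fun c d h => ?_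
        obtain ⟨-, rfl⟩ := hVm c d h
        rw [mem_ofPred_eq, he.mul_map, add_sub_cancel_left]
      exact Or.inl ((he.mul_eq hd h).symm.trans this)

end Kernel

/-! ### Comparison maps from the models -/

section Models

variable {T : Type*} [Monoid T] [TopologicalSpace T] {k : ℕ}

/-- The map from `S₂` given by its restrictions to the group of units and to the bicyclic part. -/
def ofUnitsBic (ι : ExtBicyclic →ₙ* T) (u : G₁ k → Tˣ) : S₂ k 1 → T
  | .unit g => u g
  | .bic x => ι x

/-- The map from `S₃` given by `ι` on the bicyclic part and by `kernelPoint` on the group. -/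
def ofBicKernel (ι : ExtBicyclic →ₙ* T) (e : T) : S₃ → T
  | .bic x => ι x
  | .zer m => kernelPoint ι e m

/-- The common extension of `ofUnitsBic` and `ofBicKernel` to `S₅`. -/
def ofUnitsBicKernel (ι : ExtBicyclic →ₙ* T) (u : G₁ k → Tˣ) (e : T) : S₅ k 1 → T
  | .unit g => u g
  | .bic x => ι x
  | .zer m => kernelPoint ι e m

variable [T2Space T] [IsTopologicalInverseSemigroup T] {ι : ExtBicyclic →ₙ* T} {u : G₁ k → Tˣ}

theorem units_mul_eq (hd : DenseRange ι) (hu : ∀ g, ShiftsBy ι (u g : T) g) (g h : G₁ k) :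
    (u (g + h) : T) = u g * u h :=
  (hu (g + h)).eq hd (by rw [AddSubgroup.coe_add]; exact (hu g).mul (hu h))

theorem eq_units_of_isUnit (hd : DenseRange ι) (hu : ∀ g, ShiftsBy ι (u g : T) g)
    (hall : ∀ x : Tˣ, ∃ g : G₁ k, ShiftsBy ι (x : T) g) {x : T} (hx : IsUnit x) :
    ∃ g, (u g : T) = x := by
  obtain ⟨x, rfl⟩ := hx
  obtain ⟨g, hg⟩ := hall x
  exact ⟨g, (hu g).eq hd hg⟩

omit [TopologicalSpace T] [T2Space T] [IsTopologicalInverseSemigroup T] in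
theorem units_injective (hι : Function.Injective ι) (hu : ∀ g, ShiftsBy ι (u g : T) g) :
    Function.Injective u := by
  intro g h hgh
  have h1 := hu g 0 0
  rw [hgh, hu h 0 0, hι.eq_iff, ExtBicyclic.mk.injEq] at h1
  exact Subtype.ext (by omega)

omit [TopologicalSpace T] [T2Space T] [IsTopologicalInverseSemigroup T] in
theorem units_ne_map (hι : Function.Injective ι) (g : G₁ k) (p : ExtBicyclic) :
    (u g : T) ≠ ι p := fun h => not_isUnit_map hι p (h ▸ (u g).isUnit)

theorem tendsto_units (hd : DenseRange ι)
    (h1 : Tendsto (fun i : ℤ => ι ⟨i, i⟩) atBot (𝓝 1)) (hu : ∀ g, ShiftsBy ι (u g : T) g)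
    (g : G₁ k) : Tendsto (fun i : ℤ => ι ⟨i, i + (g : ℤ)⟩) atBot (𝓝 (u g : T)) := by
  simpa [(hu g).map_mul_unit hd] using h1.mul_const (u g : T)

theorem units_union_mem_nhds (hd : DenseRange ι)
    (hu : ∀ g, ShiftsBy ι (u g : T) g) {j : ℤ}
    (hj : IsOpen ({(1 : T)} ∪ {x : T | ∃ s : ℤ, s ≤ j ∧ x = ι ⟨s, s⟩})) (g : G₁ k) :
    {(u g : T)} ∪ {x | ∃ s : ℤ, s ≤ j ∧ x = ι ⟨s, s + (g : ℤ)⟩} ∈ 𝓝 (u g : T) := by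
  have hV := hj.preimage (f := fun x : T => x * ((u g)⁻¹ : Tˣ)) (by fun_prop)
  refine mem_of_superset (hV.mem_nhds (Or.inl (by simp))) ?_
  rintro x (hx | ⟨s, hs, hx⟩)
  · rw [mem_singleton_iff, Units.mul_inv_eq_one] at hx
    exact Or.inl hx
  · rw [Units.mul_inv_eq_iff_eq_mul, (hu g).map_mul_unit hd] at hx
    exact Or.inr ⟨s, hs, hx⟩

theorem continuous_ofUnitsBic (hd : DenseRange ι)
    (h1 : Tendsto (fun i : ℤ => ι ⟨i, i⟩) atBot (𝓝 1)) (hu : ∀ g, ShiftsBy ι (u g : T) g) :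
    Continuous (ofUnitsBic ι u) := by
  refine continuous_def.2 fun U hU g hg => ?_
  obtain ⟨a, ha⟩ := eventually_atBot.1
    ((tendsto_units hd h1 hu g).eventually (hU.mem_nhds hg))
  refine ⟨a.natAbs + 1, by omega, ?_⟩
  rintro _ (rfl | ⟨q, hq, rfl⟩)
  · exact hg
  · exact ha _ (by push_cast; omega)

theorem isOpenMap_ofUnitsBic (hι : Function.Injective ι) (hd : DenseRange ι)
    (hu : ∀ g, ShiftsBy ι (u g : T) g) {j : ℤ}
    (hj : ∀ i ≤ j, IsOpen ({(1 : T)} ∪ {x : T | ∃ s : ℤ, s ≤ i ∧ x = ι ⟨s, s⟩})) :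
    IsOpenMap (ofUnitsBic ι u) := by
  intro U hU
  rw [isOpen_iff_mem_nhds]
  rintro _ ⟨g | x, hx, rfl⟩
  · obtain ⟨i, -, hi⟩ := hU g hx
    refine mem_of_superset (units_union_mem_nhds hd hu
      (hj (min j (-i)) (min_le_left _ _)) g) ?_
    rintro _ (rfl | ⟨s, hs, rfl⟩)
    · exact ⟨_, hx, rfl⟩
    · refine ⟨.bic ⟨s, s + (g : ℤ)⟩, hi (Or.inr ⟨s.natAbs, by omega, ?_⟩), rfl⟩
      rw [show -(((1 : ℕ) : ℤ) * (s.natAbs : ℤ)) = s by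
        rw [Nat.cast_one, one_mul]; omega]
  · exact mem_of_superset ((isOpen_singleton_map hι hd x).mem_nhds rfl)
      (singleton_subset_iff.2 ⟨_, hx, rfl⟩)

theorem ofUnitsBic_mul (hd : DenseRange ι)
    (hu : ∀ g, ShiftsBy ι (u g : T) g) (x y : S₂ k 1) :
    ofUnitsBic ι u (x * y) = ofUnitsBic ι u x * ofUnitsBic ι u y := by
  rcases x with g | ⟨a, b⟩ <;> rcases y with h | ⟨c, d⟩
  · exact units_mul_eq hd hu g h
  · exact (hu g c d).symm
  · exact ((hu h).map_mul_unit hd a b).symm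
  · exact map_mul ι _ _

omit [TopologicalSpace T] [T2Space T] [IsTopologicalInverseSemigroup T] in
theorem ofUnitsBic_injective (hι : Function.Injective ι) (hu : ∀ g, ShiftsBy ι (u g : T) g) :
    Function.Injective (ofUnitsBic ι u) := by
  rintro (g | x) (h | y) hxy
  · exact congrArg _ (units_injective hι hu (Units.ext hxy))
  · exact absurd hxy (units_ne_map hι g y)
  · exact absurd hxy.symm (units_ne_map hι h x)
  · exact congrArg _ (hι hxy)

variable {e : T}

theorem IsBottom.continuous_ofBicKernel [LocallyCompactSpace T] (he : IsBottom ι e)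
    (hι : Function.Injective ι) (hd : DenseRange ι)
    (h1 : Tendsto (fun i : ℤ => ι ⟨i, i⟩) atBot (𝓝 1)) : Continuous (ofBicKernel ι e) := by
  refine continuous_def.2 fun U hU m hm => ?_
  obtain ⟨a, ha⟩ := eventually_atTop.1
    ((he.tendsto_kernelPoint hι hd h1 m).eventually (hU.mem_nhds hm))
  refine ⟨a.natAbs + m.natAbs + 1, by omega, ?_⟩
  unfold S₃.basicNhd
  split_ifs with h0
  · rintro _ (rfl | ⟨c, hc, rfl⟩)
    · exact hm
    · exact ha _ (by omega)
  · rintro _ (rfl | ⟨c, hc, rfl⟩)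
    · exact hm
    · have := ha (c - m) (by omega)
      rwa [sub_add_cancel] at this

theorem IsBottom.isOpenMap_ofBicKernel [LocallyCompactSpace T] (he : IsBottom ι e)
    (hι : Function.Injective ι) (hd : DenseRange ι)
    (h1 : Tendsto (fun i : ℤ => ι ⟨i, i⟩) atBot (𝓝 1)) : IsOpenMap (ofBicKernel ι e) := by
  intro U hU
  rw [isOpen_iff_mem_nhds]
  rintro _ ⟨x | m, hx, rfl⟩
  · exact mem_of_superset ((isOpen_singleton_map hι hd x).mem_nhds rfl)
      (singleton_subset_iff.2 ⟨_, hx, rfl⟩)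
  · obtain ⟨i, -, hi⟩ := hU m hx
    -- For m < 0 the basic sets are indexed by the second coordinate s + m, hence the margin |m|.
    refine mem_of_superset (he.kernelPoint_union_mem_nhds hι hd h1 m (i + m.natAbs)) ?_
    rintro _ (rfl | ⟨s, hs, rfl⟩)
    · exact ⟨_, hx, rfl⟩
    · refine ⟨.bic ⟨s, s + m⟩, hi ?_, rfl⟩
      unfold S₃.basicNhd
      split_ifs with h0
      · exact Or.inr ⟨s, by omega, rfl⟩
      · exact Or.inr ⟨s + m, by omega, by rw [add_sub_cancel_right]⟩

theorem IsBottom.ofUnitsBicKernel_mul (he : IsBottom ι e) (hι : Function.Injective ι)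
    (hd : DenseRange ι) (h1 : Tendsto (fun i : ℤ => ι ⟨i, i⟩) atBot (𝓝 1))
    (hu : ∀ g, ShiftsBy ι (u g : T) g) (x y : S₅ k 1) :
    ofUnitsBicKernel ι u e (x * y) = ofUnitsBicKernel ι u e x * ofUnitsBicKernel ι u e y := by
  have hum : ∀ (g : G₁ k) (m : ℤ), (u g : T) * kernelPoint ι e m = kernelPoint ι e (g + m) := by
    intro g m
    rw [kernelPoint, ← mul_assoc, ← he.comm hι hd h1, mul_assoc, hu g, he.mul_map]
    congr 1
    ring
  rcases x with g | ⟨a, b⟩ | m <;> rcases y with h | ⟨c, d⟩ | l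
  · exact units_mul_eq hd hu g h
  · exact (hu g c d).symm
  · exact (hum g l).symm
  · exact ((hu h).map_mul_unit hd a b).symm
  · exact map_mul ι _ _
  · exact (he.map_mul_kernelPoint hι hd h1 l a b).symm
  · change kernelPoint ι e (h + m) = kernelPoint ι e m * u h
    rw [kernelPoint, kernelPoint, mul_assoc, (hu h).map_mul_unit hd, add_comm]
  · exact (he.kernelPoint_mul_map m c d).symm
  · exact (he.kernelPoint_mul_kernelPoint hι hd h1 m l).symm

theorem IsBottom.ofUnitsBicKernel_injective [LocallyCompactSpace T] (he : IsBottom ι e)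
    (hι : Function.Injective ι) (hd : DenseRange ι)
    (h1 : Tendsto (fun i : ℤ => ι ⟨i, i⟩) atBot (𝓝 1)) (hu : ∀ g, ShiftsBy ι (u g : T) g) :
    Function.Injective (ofUnitsBicKernel ι u e) := by
  have habs := he.absorbsDiag_kernelPoint hι hd h1
  have hr : ∀ m x, kernelPoint ι e m ≠ ι x := fun m x h =>
    not_mem_range_of_diag_mul hι (fun a => (habs m a).1) ⟨x, h.symm⟩
  have hun : ∀ m (g : G₁ k), kernelPoint ι e m ≠ u g := fun m g h =>
    not_isUnit_of_diag_mul hι (habs m 0).1 (h ▸ (u g).isUnit)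
  rintro (g | x | m) (h | y | l) hxy
  · exact congrArg _ (units_injective hι hu (Units.ext hxy))
  · exact absurd hxy (units_ne_map hι g y)
  · exact absurd hxy.symm (hun l g)
  · exact absurd hxy.symm (units_ne_map hι h x)
  · exact congrArg _ (hι hxy)
  · exact absurd hxy.symm (hr l x)
  · exact absurd hxy (hun m h)
  · exact absurd hxy (hr m y)
  · exact congrArg _ (he.kernelPoint_injective hι hd h1 hxy)

omit [TopologicalSpace T] [T2Space T] [IsTopologicalInverseSemigroup T] in
theorem ofUnitsBicKernel_ofS₂ (x : S₂ k 1) :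
    ofUnitsBicKernel ι u e (S₅.ofS₂ x) = ofUnitsBic ι u x := by cases x <;> rfl

omit [TopologicalSpace T] [T2Space T] [IsTopologicalInverseSemigroup T] in
theorem ofUnitsBicKernel_ofS₃ (x : S₃) :
    ofUnitsBicKernel ι u e (S₅.ofS₃ x) = ofBicKernel ι e x := by cases x <;> rfl

omit [T2Space T] [IsTopologicalInverseSemigroup T] in
theorem continuous_ofUnitsBicKernel (h₂ : Continuous (ofUnitsBic ι u))
    (h₃ : Continuous (ofBicKernel ι e)) : Continuous (ofUnitsBicKernel ι u e) := by
  refine continuous_def.2 fun U hU => ?_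
  have : ofUnitsBicKernel ι u e ⁻¹' U =
      S₅.ofS₂ '' (ofUnitsBic ι u ⁻¹' U) ∪ S₅.ofS₃ '' (ofBicKernel ι e ⁻¹' U) := by
    ext x
    constructor
    · intro hx
      rcases x with g | x | m
      · exact Or.inl ⟨.unit g, hx, rfl⟩
      · exact Or.inl ⟨.bic x, hx, rfl⟩
      · exact Or.inr ⟨.zer m, hx, rfl⟩
    · rintro (⟨y, hy, rfl⟩ | ⟨y, hy, rfl⟩)
      · rwa [mem_preimage, ofUnitsBicKernel_ofS₂]
      · rwa [mem_preimage, ofUnitsBicKernel_ofS₃]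
  rw [this]
  exact (TopologicalSpace.isOpen_generateFrom_of_mem (Or.inl ⟨_, hU.preimage h₂, rfl⟩)).union
    (TopologicalSpace.isOpen_generateFrom_of_mem (Or.inr ⟨_, hU.preimage h₃, rfl⟩))

end Models

/-! ### The classification -/

theorem mainTheorem10 {T : Type*} [Monoid T] [TopologicalSpace T] [T2Space T]
    [LocallyCompactSpace T] [IsTopologicalInverseSemigroup T]
    (ι : ExtBicyclic →ₙ* T) (hι : Function.Injective ι) (hdense : DenseRange ι)
    (hunits : Nontrivial Tˣ)
    (hK : ∃ j : ℤ, IsCompact ({(1 : T)} ∪ {x : T | ∃ i : ℤ, i ≤ j ∧ x = ι ⟨i, i⟩})) :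
    (∃ m : ℕ → ℤ, (∀ i, m i < 0) ∧ (∀ i, m (i + 1) = m i - 1) ∧
      (𝓝 (1 : T)).HasBasis (fun _ : ℕ => True)
        (fun p => {(1 : T)} ∪ {x : T | ∃ i : ℕ, p ≤ i ∧ x = ι ⟨m i, m i⟩})) ∧
    ∃ k : ℕ, 0 < k ∧ (Nonempty (T ≃ₜ* S₂ k 1) ∨ Nonempty (T ≃ₜ* S₅ k 1)) := by
  obtain ⟨j, hK⟩ := hK
  have h1 := tendsto_diag_atBot hι hdense hK
  have hopen := fun i => isOpen_one_union_diag hι hdense hK (i := i)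
  -- Starting at min(j,-1) keeps the sequence negative and inside `K`.
  refine ⟨⟨fun i => min j (-1) - i, fun i => ?_, fun i => ?_, ⟨fun U => ⟨fun hU => ?_, ?_⟩⟩⟩, ?_⟩
  · dsimp only
    omega
  · push_cast
    ring
  · obtain ⟨a, ha⟩ := eventually_atBot.1 (h1.eventually hU)
    refine ⟨a.natAbs + j.natAbs + 1, trivial, ?_⟩
    rintro _ (rfl | ⟨i, hi, rfl⟩)
    · exact mem_of_mem_nhds hU
    · exact ha _ (by dsimp only; omega)
  · rintro ⟨p, -, hp⟩
    refine mem_of_superset ((hopen (min j (-1) - p) (by omega)).mem_nhds (Or.inl rfl))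
      (Subset.trans ?_ hp)
    rintro x (rfl | ⟨s, hs, rfl⟩)
    · exact Or.inl rfl
    · refine Or.inr ⟨(min j (-1) - s).toNat, by omega, ?_⟩
      dsimp only
      rw [Int.toNat_of_nonneg (by omega), sub_sub_cancel]
  · obtain ⟨k, hk, hall, u, hu⟩ := exists_units_shiftsBy hι hdense
    refine ⟨k, hk, ?_⟩
    have hc₂ := continuous_ofUnitsBic hdense h1 hu
    have ho₂ := isOpenMap_ofUnitsBic hι hdense hu hopen
    by_cases hz : ∃ x, AbsorbsDiag ι x
    · obtain ⟨x, hx⟩ := hz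
      obtain ⟨e, he⟩ := exists_isBottom hι hdense h1 hx
      have hc₃ := he.continuous_ofBicKernel hι hdense h1
      have ho₃ := he.isOpenMap_ofBicKernel hι hdense h1
      have hsurj : Function.Surjective (ofUnitsBicKernel ι u e) := by
        intro y
        rcases mem_range_or_isUnit_or_absorbsDiag hι hdense h1 y with ⟨p, rfl⟩ | h | h
        · exact ⟨.bic p, rfl⟩
        · obtain ⟨g, hg⟩ := eq_units_of_isUnit hdense hu hall h
          exact ⟨.unit g, hg⟩
        · obtain ⟨m, hm⟩ := he.exists_kernelPoint_eq hι hdense h1 h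
          exact ⟨.zer m, hm⟩
      let E : S₅ k 1 ≃ T := Equiv.ofBijective _
        ⟨he.ofUnitsBicKernel_injective hι hdense h1 hu, hsurj⟩
      let F : S₅ k 1 ≃ₜ* T :=
        { E with
          map_mul' := he.ofUnitsBicKernel_mul hι hdense h1 hu
          continuous_toFun := continuous_ofUnitsBicKernel hc₂ hc₃
          continuous_invFun := by
            -- Openness need only be checked on the generators of τ₅, which are images of open sets
            -- of S₂ and S₃.
            refine continuous_generateFrom_iff.2 ?_
            rintro _ (⟨U, hU, rfl⟩ | ⟨U, hU, rfl⟩)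
            · convert ho₂ U hU
              rw [Equiv.invFun_as_coe, ← Equiv.image_eq_preimage_symm, image_image]
              exact image_congr fun x _ => ofUnitsBicKernel_ofS₂ x
            · convert ho₃ U hU
              rw [Equiv.invFun_as_coe, ← Equiv.image_eq_preimage_symm, image_image]
              exact image_congr fun x _ => ofUnitsBicKernel_ofS₃ x }
      exact Or.inr ⟨F.symm⟩
    · have hsurj : Function.Surjective (ofUnitsBic ι u) := by
        intro y
        rcases mem_range_or_isUnit_or_absorbsDiag hι hdense h1 y with ⟨p, rfl⟩ | h | h
        · exact ⟨.bic p, rfl⟩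
        · obtain ⟨g, hg⟩ := eq_units_of_isUnit hdense hu hall h
          exact ⟨.unit g, hg⟩
        · exact absurd ⟨y, h⟩ hz
      let E : S₂ k 1 ≃ T := Equiv.ofBijective _ ⟨ofUnitsBic_injective hι hu, hsurj⟩
      let F : S₂ k 1 ≃ₜ* T :=
        { E with
          map_mul' := ofUnitsBic_mul hdense hu
          continuous_toFun := hc₂
          continuous_invFun := (E.toHomeomorphOfContinuousOpen hc₂ ho₂).symm.continuous }
      exact Or.inl ⟨F.symm⟩
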